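/- Let $x_1,\dots,x_n\in\mathbb R^k$ be distinct points and let $\lambda_1,\dots,\lambda_n\in\mathbb R$ satisfy $\sum_i\lambda_i=0$. Put $I_+=\{i:\lambda_i>0\}$ (sources) and $I_-=\{j:\lambda_j<0\}$ (sinks), and let $$\mathcal Q_\lambda=\Big\{(A_{ij})_{i\in I_+,\,j\in I_-}:\ A_{ij}\ge 0,\ \ \sum_{j\in I_-}A_{ij}=\lambda_i\ (i\in I_+),\ \ \sum_{i\in I_+}A_{ij}=-\lambda_j\ (j\in I_-)\Big\},$$ $$W^{(1)}(\lambda)=\min_{A\in\mathcal Q_\lambda}\ \sum_{i\in I_+}\sum_{j\in I_-}A_{ij}\,|x_i-x_j| ,$$ where the minimum is attained; a plan $A^o\in\mathcal Q_\lambda$ attaining it is called optimal. A pair $(\mu,\vec E)$ is admissible if $\mu$ is a Borel probability measure on $\mathbb R^k$ and $\vec E$ is an $\mathbb R^k$-valued Borel measure on $\mathbb R^k$, absolutely continuous with respect to $\mu$, with $d\vec E/d\mu\in L^2(\mu)$ and $\nabla\cdot\vec E=\sum_{i}\lambda_i\delta_{x_i}$ on $\mathbb R^k$ in the sense of distributions.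 Its stationary action (for the potential $V\equiv 0$) is $\frac12\int_{\mathbb R^k}|d\vec E/d\mu|^2\,d\mu$. A measure $\mu$ is called an action minimizer if some admissible pair $(\mu,\vec E)$ minimizes the action among all admissible pairs. 1. The minimal stationary action exists and equals $\frac12\big[W^{(1)}(\lambda)\big]^2$. 2. Suppose that $\lambda\ne 0$. Then $W^{(1)}(\lambda)>0$. Write $L(i,j)$ for the straight segment from $x_i$ to $x_j$ and $\mu_{i,j}$ for the uniform probability measure on $L(i,j)$. A measure $\mu$ is an action minimizer if and only if there is an optimal plan $A^o$ with $$\mu=\sum_{i\in I_+}\sum_{j\in I_-}\frac{A^o_{ij}\,|x_i-x_j|}{W^{(1)}(\lambda)}\ \mu_{i,j}.$$ Such a measure $\mu$ is supported on the union of the segments $L(i,j)$ with $A^o_{ij}>0$. If $A^o_{ij}>0$ and $L(i,j)$ meets every other segment $L(i',j')$ with $A^o_{i'j'}>0$ in at most one point, then the restriction of $\mu$ to $L(i,j)$ is uniform and $$\mu(L(i,j))=\frac{A^o_{ij}\,|x_i-x_j|}{W^{(1)}(\lambda)} .$$ -/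

import Mathlib

open MeasureTheory Set
open scoped ENNReal ContDiff

noncomputable section

namespace SteadyFlow

/-- Euclidean space `ℝᵏ`. -/
abbrev Eu (k : ℕ) : Type := EuclideanSpace ℝ (Fin k)

/-! ### The stationary extended action with point sources and sinks -/

/-- The `i`-th component of an `ℝᵏ`-valued Borel measure, a finite signed measure. -/
def component {k : ℕ} (E : VectorMeasure (Eu k) (Eu k)) (i : Fin k) : SignedMeasure (Eu k) :=
  E.mapRange (EuclideanSpace.proj i : Eu k →L[ℝ] ℝ).toLinearMap.toAddMonoidHom
    (EuclideanSpace.proj i : Eu k →L[ℝ] ℝ).continuous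

lemma component_apply {k : ℕ} (E : VectorMeasure (Eu k) (Eu k)) (i : Fin k) (s : Set (Eu k)) :
    component E i s = E s i := rfl

/-- The Radon-Nikodym derivative `dE/dμ`, taken component by component. -/
def fluxDensity {k : ℕ} (μ : Measure (Eu k)) (E : VectorMeasure (Eu k) (Eu k)) (y : Eu k) :
    Eu k :=
  WithLp.toLp 2 fun i => (component E i).rnDeriv μ y

/-- `∇ · E = ∑ i, lam i • δ_(x i)` on `ℝᵏ` in the sense of distributions. -/
def HasPointSources {k n : ℕ} (x : Fin n → Eu k) (lam : Fin n → ℝ)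
    (E : VectorMeasure (Eu k) (Eu k)) : Prop :=
  ∀ φ : Eu k → ℝ, ContDiff ℝ ∞ φ → HasCompactSupport φ →
    - (∫ᵛ y, gradient φ y ∂[innerSL ℝ; E]) = ∑ i, lam i * φ (x i)

/-- The admissible pairs: `μ` is a Borel probability measure, `E ≪ μ` with `dE/dμ ∈ L²(μ)`, and
`E` has the prescribed sources and sinks. -/
structure IsAdmissible {k n : ℕ} (x : Fin n → Eu k) (lam : Fin n → ℝ)
    (μ : Measure (Eu k)) (E : VectorMeasure (Eu k) (Eu k)) : Prop where
  isProbabilityMeasure : IsProbabilityMeasure μ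
  absolutelyContinuous : E.AbsolutelyContinuous μ.toENNRealVectorMeasure
  memLp : MemLp (fluxDensity μ E) 2 μ
  hasPointSources : HasPointSources x lam E

/-- The stationary extended action `½ ∫ |dE/dμ|² dμ - ∫ V dμ`. -/
def action {k : ℕ} (V : Eu k → ℝ) (μ : Measure (Eu k)) (E : VectorMeasure (Eu k) (Eu k)) : ℝ :=
  1 / 2 * ∫ y, ‖fluxDensity μ E y‖ ^ 2 ∂μ - ∫ y, V y ∂μ

/-- The set of all values of the action on admissible pairs. -/
def actionValues {k n : ℕ} (V : Eu k → ℝ) (x : Fin n → Eu k) (lam : Fin n → ℝ) : Set ℝ :=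
  {a | ∃ (μ : Measure (Eu k)) (E : VectorMeasure (Eu k) (Eu k)),
    IsAdmissible x lam μ E ∧ a = action V μ E}

/-- `μ` is an action minimizer: together with a suitable `E` it realizes the minimum of the
action over all admissible pairs. -/
def IsActionMinimizer {k n : ℕ} (V : Eu k → ℝ) (x : Fin n → Eu k) (lam : Fin n → ℝ)
    (μ : Measure (Eu k)) : Prop :=
  ∃ E : VectorMeasure (Eu k) (Eu k), IsAdmissible x lam μ E ∧
    ∀ (μ' : Measure (Eu k)) (E' : VectorMeasure (Eu k) (Eu k)),
      IsAdmissible x lam μ' E' → action V μ E ≤ action V μ' E'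

/-! ### The discrete transport problem -/

/-- The sources `I₊`. -/
abbrev Source {n : ℕ} (lam : Fin n → ℝ) : Type := {i : Fin n // 0 < lam i}

/-- The sinks `I₋`. -/
abbrev Sink {n : ℕ} (lam : Fin n → ℝ) : Type := {j : Fin n // lam j < 0}

/-- The transport plans from the sources to the sinks. -/
def plans {n : ℕ} (lam : Fin n → ℝ) : Set (Matrix (Source lam) (Sink lam) ℝ) :=
  {A | (∀ i j, 0 ≤ A i j) ∧ (∀ i, ∑ j, A i j = lam i) ∧ (∀ j, ∑ i, A i j = - lam j)}

/-- The cost `∑ A_ij |x_i - x_j|` of a plan. -/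
def cost {k n : ℕ} (x : Fin n → Eu k) (lam : Fin n → ℝ)
    (A : Matrix (Source lam) (Sink lam) ℝ) : ℝ :=
  ∑ i, ∑ j, A i j * dist (x i) (x j)

/-- The discrete Euclidean 1-Wasserstein cost `W⁽¹⁾(lam)`. -/
def wasserstein {k n : ℕ} (x : Fin n → Eu k) (lam : Fin n → ℝ) : ℝ :=
  sInf (cost x lam '' plans lam)

/-- `A` realizes the minimal transport cost. -/
def IsOptimalPlan {k n : ℕ} (x : Fin n → Eu k) (lam : Fin n → ℝ)
    (A : Matrix (Source lam) (Sink lam) ℝ) : Prop :=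
  A ∈ plans lam ∧ ∀ B ∈ plans lam, cost x lam A ≤ cost x lam B

/-! ### Measures on the edges of the bipartite graph -/

/-- The uniform probability measure on the segment with end points `a` and `b`. -/
def uniformOnSegment {k : ℕ} (a b : Eu k) : Measure (Eu k) :=
  ((volume : Measure ℝ).restrict (Icc 0 1)).map (AffineMap.lineMap a b)

/-- The edge `L(i,j)`: the straight segment from the source `x i` to the sink `x j`. -/
def edge {k n : ℕ} (x : Fin n → Eu k) (lam : Fin n → ℝ) (i : Source lam) (j : Sink lam) :
    Set (Eu k) :=
  segment ℝ (x i) (x j)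

/-- The mass `A_ij |x_i - x_j| / W⁽¹⁾(lam)` attached to the edge `L(i,j)`. -/
def edgeMass {k n : ℕ} (x : Fin n → Eu k) (lam : Fin n → ℝ)
    (A : Matrix (Source lam) (Sink lam) ℝ) (i : Source lam) (j : Sink lam) : ℝ≥0∞ :=
  ENNReal.ofReal (A i j * dist (x i) (x j) / wasserstein x lam)

/-- The superposition of the uniform measures on the edges `L(i,j)` with total masses
`edgeMass x lam A i j`. -/
def edgeMeasure {k n : ℕ} (x : Fin n → Eu k) (lam : Fin n → ℝ)
    (A : Matrix (Source lam) (Sink lam) ℝ) : Measure (Eu k) :=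
  ∑ i, ∑ j, edgeMass x lam A i j • uniformOnSegment (x i) (x j)

end SteadyFlow

end

open SteadyFlow

namespace SteadyFlow

/-! ### Vector measures with a density -/

section Density

open Filter Topology

variable {X E F G : Type*} {mX : MeasurableSpace X}
  [NormedAddCommGroup E] [NormedSpace ℝ E] [NormedAddCommGroup F] [NormedSpace ℝ F]
  [NormedAddCommGroup G] [NormedSpace ℝ G]
  {μ : Measure X} {f : X → F}

/-! The lower bound is Kantorovich–Rubinstein duality. Write `f = dE/dμ` and `W` for the transport
cost. Testing the divergence with compactly supported 1-Lipschitz potentials `u` gives `∑ λ_i u(x_i)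
≤ ∫ |f| dμ`, hence `W ≤ ∫ |f| dμ`. As `μ` is a probability measure, `W² ≤ ∫ |f|² dμ`, with equality
only if `|f| = W` almost everywhere. Conversely, an optimal plan `A` gives each edge the mass `A_ij
|x_i - x_j| / W` and a flux of speed `W` along it. The superposition is admissible and has `∫ |f|² ≤
W²` (`exists_isAdmissible_edgeMeasure`).

That every minimizer has this form is proved by perturbing the metric, without decomposing the flux
into paths. For a test function `ψ` and small `t`, `perturbedDist` weights straight segments from a
source by `1 - t ψ`. Its slope is at most `1 - t ψ + O(t²)`, so duality yields a plan `A_t` of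
perturbed cost at most `∫ (1 - t ψ + O(t²)) |f| dμ = W (1 - t ∫ ψ dμ + O(t²))`. The unperturbed cost
of `A_t` is at least `W`. Cancelling `W`, dividing by `t` and letting `t → 0` gives an optimal plan
whose edge measure `ν` satisfies `∫ ψ dμ ≤ ∫ ψ dν` (`IsAdmissible.exists_isOptimalPlan_le`).

This plan depends on `ψ`. The optimal plans form a compact convex set on which the integral of `ψ`
against the edge measure is affine. Hahn–Banach separation therefore produces one plan that is exact
for finitely many test functions, and compactness one for all of them
(`IsAdmissible.exists_eq_edgeMeasure`). -/

lemma integrable_bilin_of_bound (hf : Integrable f μ) {g : X → E} (hg : StronglyMeasurable g)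
    {C : ℝ} (hC : ∀ x, ‖g x‖ ≤ C) (B : E →L[ℝ] F →L[ℝ] G) :
    Integrable (fun x => B (g x) (f x)) μ := by
  refine Integrable.mono' (hf.norm.const_mul (‖B‖ * C))
    (B.aestronglyMeasurable_comp₂ hg.aestronglyMeasurable hf.1) (.of_forall fun x => ?_)
  calc ‖B (g x) (f x)‖ ≤ ‖B‖ * ‖g x‖ * ‖f x‖ := B.le_opNorm₂ _ _
    _ ≤ ‖B‖ * C * ‖f x‖ := by gcongr; exact hC x

variable [CompleteSpace F]

lemma isFiniteMeasure_variation_withDensityᵥ (hf : Integrable f μ) :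
    IsFiniteMeasure (μ.withDensityᵥ f).variation := by
  rw [Measure.variation_withDensityᵥ hf]
  exact isFiniteMeasure_withDensity hf.2.ne

variable [CompleteSpace G]

lemma integral_withDensityᵥ_simpleFunc (hf : Integrable f μ) (B : E →L[ℝ] F →L[ℝ] G)
    (g : SimpleFunc X E) :
    ∫ᵛ x, g x ∂[B; μ.withDensityᵥ f] = ∫ x, B (g x) (f x) ∂μ := by
  have hfin := isFiniteMeasure_variation_withDensityᵥ hf
  induction g using SimpleFunc.induction with
  | const c hs =>
    rename_i s
    have h1 : ⇑(SimpleFunc.piecewise s hs (SimpleFunc.const X c) (SimpleFunc.const X 0))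
        = s.indicator fun _ => c := by
      ext x; simp [SimpleFunc.coe_piecewise, Set.indicator, Set.piecewise]
    rw [h1]
    have h2 : (fun x => B (s.indicator (fun _ => c) x) (f x)) = s.indicator (fun x => B c (f x)) := by
      ext x
      by_cases hx : x ∈ s <;> simp [hx]
    rw [h2, integral_indicator hs, VectorMeasure.integral_eq_setToFun,
      setToFun_indicator_const _ hs (measure_ne_top _ _),
      ContinuousLinearMap.integral_comp_comm _ hf.integrableOn,
      ← withDensityᵥ_apply hf hs]
    rfl
  | add _ h₁ h₂ =>
    rename_i g₁ g₂ _
    have hi (g : SimpleFunc X E) : (μ.withDensityᵥ f).Integrable g :=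
      SimpleFunc.integrable_of_isFiniteMeasure g
    obtain ⟨C₁, hC₁⟩ := g₁.exists_forall_norm_le
    obtain ⟨C₂, hC₂⟩ := g₂.exists_forall_norm_le
    simp only [SimpleFunc.coe_add, Pi.add_apply, map_add, _root_.add_apply]
    rw [VectorMeasure.integral_fun_add (hi g₁) (hi g₂), h₁, h₂, integral_add
      (integrable_bilin_of_bound hf g₁.stronglyMeasurable hC₁ B)
      (integrable_bilin_of_bound hf g₂.stronglyMeasurable hC₂ B)]

/-- A bounded function is integrated against the vector measure `f μ` by integrating its pairing
with `f` against `μ`. -/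
lemma integral_withDensityᵥ (hf : Integrable f μ) (B : E →L[ℝ] F →L[ℝ] G) {g : X → E}
    (hg : StronglyMeasurable g) {C : ℝ} (hC : ∀ x, ‖g x‖ ≤ C) :
    ∫ᵛ x, g x ∂[B; μ.withDensityᵥ f] = ∫ x, B (g x) (f x) ∂μ := by
  have hfin := isFiniteMeasure_variation_withDensityᵥ hf
  -- The bound `hC` yields `0 ≤ C` only through a point of `X`.
  rcases isEmpty_or_nonempty X with hX | ⟨⟨x₀⟩⟩
  · simp [VectorMeasure.integral_of_isEmpty, Measure.eq_zero_of_isEmpty μ]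
  have hC0 : 0 ≤ C := (norm_nonneg _).trans (hC x₀)
  have hlim x := hg.tendsto_approxBounded_of_norm_le (hC x)
  have hb n x := hg.norm_approxBounded_le hC0 n x
  refine tendsto_nhds_unique
    (VectorMeasure.tendsto_integral_of_dominated_convergence (fun _ => C)
      (fun n => (hg.approxBounded C n).aestronglyMeasurable) (integrable_const C)
      (fun n => .of_forall (hb n)) (.of_forall hlim)) ?_
  simp_rw [integral_withDensityᵥ_simpleFunc hf B]
  refine tendsto_integral_of_dominated_convergence (fun x => ‖B‖ * C * ‖f x‖)
    (fun n => (integrable_bilin_of_bound hf (hg.approxBounded C n).stronglyMeasurable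
      (hb n) B).1) (hf.norm.const_mul _) (fun n => .of_forall fun x => ?_)
    (.of_forall fun x => ?_)
  · calc ‖B (hg.approxBounded C n x) (f x)‖ ≤ ‖B‖ * ‖hg.approxBounded C n x‖ * ‖f x‖ :=
        B.le_opNorm₂ _ _
      _ ≤ ‖B‖ * C * ‖f x‖ := by gcongr; exact hb n x
  · exact ((B.flip (f x)).continuous.tendsto _).comp (hlim x)

end Density

/-! ### The flux density -/

variable {k n : ℕ} {μ : Measure (Eu k)} {E : VectorMeasure (Eu k) (Eu k)}

lemma integrable_fluxDensity (μ : Measure (Eu k)) (E : VectorMeasure (Eu k) (Eu k)) :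
    Integrable (fluxDensity μ E) μ :=
  Integrable.of_eval_piLp fun i => SignedMeasure.integrable_rnDeriv (component E i) μ

lemma component_withDensityᵥ {F : Eu k → Eu k} (hF : Integrable F μ) (i : Fin k) :
    component (μ.withDensityᵥ F) i = μ.withDensityᵥ fun y => F y i := by
  have hFi : ∀ i, Integrable (fun y => F y i) μ := integrable_piLp_iff.1 hF
  ext s hs
  rw [component_apply, withDensityᵥ_apply hF hs, withDensityᵥ_apply (hFi i) hs]
  exact eval_integral_piLp (fun i => (hFi i).integrableOn) i

/-- Radon–Nikodym in each coordinate: absolute continuity passes from `E` to its components. -/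
lemma withDensityᵥ_fluxDensity [SigmaFinite μ]
    (h : E.AbsolutelyContinuous μ.toENNRealVectorMeasure) :
    μ.withDensityᵥ (fluxDensity μ E) = E := by
  have hF := integrable_fluxDensity μ E
  ext s hs i
  have h1 : component E i ≪ᵥ μ.toENNRealVectorMeasure := fun t ht => by
    rw [component_apply, h ht]; rfl
  have h2 := (SignedMeasure.absolutelyContinuous_iff_withDensityᵥ_rnDeriv_eq _ _).1 h1
  have h3 := component_withDensityᵥ hF i
  rw [← component_apply, ← component_apply, h3]
  exact congrArg (fun ν : SignedMeasure (Eu k) => ν s) h2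

lemma fluxDensity_withDensityᵥ [SigmaFinite μ] {F : Eu k → Eu k} (hF : Integrable F μ) :
    fluxDensity μ (μ.withDensityᵥ F) =ᵐ[μ] F := by
  have key : ∀ i, (component (μ.withDensityᵥ F) i).rnDeriv μ =ᵐ[μ] fun y => F y i := fun i => by
    refine Integrable.ae_eq_of_withDensityᵥ_eq (SignedMeasure.integrable_rnDeriv _ _)
      (integrable_piLp_iff.1 hF i) ?_
    have h1 := component_withDensityᵥ hF i
    have h2 : component (μ.withDensityᵥ F) i ≪ᵥ μ.toENNRealVectorMeasure :=
      h1 ▸ Measure.withDensityᵥ_absolutelyContinuous μ _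
    rw [(SignedMeasure.absolutelyContinuous_iff_withDensityᵥ_rnDeriv_eq _ _).1 h2, h1]
  filter_upwards [ae_all_iff.2 key] with y hy
  ext i
  exact hy i

lemma withDensityᵥ_absolutelyContinuous {F : Eu k → Eu k} (hF : Integrable F μ) :
    (μ.withDensityᵥ F).AbsolutelyContinuous μ.toENNRealVectorMeasure := by
  refine VectorMeasure.AbsolutelyContinuous.mk fun i hi₁ hi₂ => ?_
  rw [Measure.toENNRealVectorMeasure_apply_measurable hi₁] at hi₂
  rw [withDensityᵥ_apply hF hi₁, Measure.restrict_zero_set hi₂, integral_zero_measure]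

lemma norm_gradient (φ : Eu k → ℝ) (y : Eu k) : ‖gradient φ y‖ = ‖fderiv ℝ φ y‖ := by
  simp [gradient]

lemma inner_gradient (φ : Eu k → ℝ) (y v : Eu k) :
    inner ℝ (gradient φ y) v = fderiv ℝ φ y v := by
  simp [gradient]

lemma integral_gradient_withDensityᵥ {F : Eu k → Eu k} (hF : Integrable F μ) {φ : Eu k → ℝ}
    (hφ : ContDiff ℝ ∞ φ) (hc : HasCompactSupport φ) :
    ∫ᵛ y, gradient φ y ∂[innerSL ℝ; μ.withDensityᵥ F] = ∫ y, fderiv ℝ φ y (F y) ∂μ := by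
  have h1 : Continuous (fderiv ℝ φ) := hφ.continuous_fderiv (by simp)
  obtain ⟨C, hC⟩ := (hc.fderiv (𝕜 := ℝ)).exists_bound_of_continuous h1
  have h2 : Continuous (gradient φ) :=
    (InnerProductSpace.toDual ℝ (Eu k)).symm.continuous.comp h1
  rw [integral_withDensityᵥ hF (innerSL ℝ) h2.stronglyMeasurable (C := C)
    fun y => (norm_gradient φ y).trans_le (hC y)]
  exact integral_congr_ae (.of_forall fun y => inner_gradient φ y (F y))

/-- Turns the distributional equation into an ordinary integral against `μ`; the lower bound uses
the sources and sinks only through it. -/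
lemma IsAdmissible.sum_eq {x : Fin n → Eu k} {lam : Fin n → ℝ} (h : IsAdmissible x lam μ E)
    {φ : Eu k → ℝ} (hφ : ContDiff ℝ ∞ φ) (hc : HasCompactSupport φ) :
    ∑ i, lam i * φ (x i) = - ∫ y, fderiv ℝ φ y (fluxDensity μ E y) ∂μ := by
  have := h.isProbabilityMeasure
  rw [← h.hasPointSources φ hφ hc, ← integral_gradient_withDensityᵥ
    (integrable_fluxDensity μ E) hφ hc, withDensityᵥ_fluxDensity h.absolutelyContinuous]

/-! ### Test functions with a pointwise slope bound -/

/-- The slope of `u` at `y` is at most `w y`, with an error that is linear in the distance. -/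
def HasSlopeBound {k : ℕ} (u w : Eu k → ℝ) (L : ℝ) : Prop :=
  ∀ y z, |u y - u z| ≤ ‖y - z‖ * (w y + L * ‖y - z‖)

variable {k n : ℕ} {u w : Eu k → ℝ} {L : ℝ}

section Mollify

open Filter Topology

lemma HasSlopeBound.continuous (h : HasSlopeBound u w L) : Continuous u := by
  refine continuous_iff_continuousAt.2 fun y => ?_
  rw [ContinuousAt, tendsto_iff_dist_tendsto_zero]
  have h1 : Continuous fun z : Eu k => ‖y - z‖ * (w y + L * ‖y - z‖) := by fun_prop
  have h2 := h1.tendsto y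
  simp only [sub_self, norm_zero, zero_mul] at h2
  refine squeeze_zero (fun _ => dist_nonneg) (fun z => ?_) h2
  rw [dist_comm, Real.dist_eq]
  exact h y z

lemma continuous_of_abs_sub_le (h : ∀ y z, |w y - w z| ≤ L * ‖y - z‖) : Continuous w :=
  (LipschitzWith.of_dist_le' (K := L) fun y z => by
    rw [Real.dist_eq, dist_eq_norm]; exact h y z).continuous

/-- Mollification with a bump of radius `r` increases the slope by at most `L * r`. -/
lemma HasSlopeBound.norm_fderiv_convolution_le (h : HasSlopeBound u w L)
    (hw0 : ∀ y, 0 ≤ w y) (hL : 0 ≤ L) (hw : ∀ y z, |w y - w z| ≤ L * ‖y - z‖)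
    (ρ : ContDiffBump (0 : Eu k)) (y : Eu k) :
    ‖fderiv ℝ (convolution (ρ.normed volume) u (ContinuousLinearMap.lsmul ℝ ℝ) volume) y‖
      ≤ w y + L * ρ.rOut := by
  set φ := convolution (ρ.normed volume) u (ContinuousLinearMap.lsmul ℝ ℝ) volume with hφ
  have hsm : ContDiff ℝ 1 φ :=
    ρ.hasCompactSupport_normed.contDiff_convolution_left _ ρ.contDiff_normed
      h.continuous.locallyIntegrable
  have hint (z : Eu k) : Integrable (fun t => ρ.normed volume t * u (z - t)) volume := by
    refine Continuous.integrable_of_hasCompactSupport ?_ ?_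
    · exact ρ.continuous_normed.mul (h.continuous.comp (by fun_prop))
    · exact ρ.hasCompactSupport_normed.mul_right
  have hval (z : Eu k) : φ z = ∫ t, ρ.normed volume t * u (z - t) := by
    simp [hφ, convolution]
  have hr := ρ.rOut_pos
  have key (z : Eu k) : ‖φ z - φ y‖ ≤ ‖z - y‖ * (w y + L * ρ.rOut + L * ‖z - y‖) := by
    have hbd : ‖∫ t, (ρ.normed volume t * u (z - t) - ρ.normed volume t * u (y - t))‖
        ≤ ∫ t, ρ.normed volume t * (‖z - y‖ * (w y + L * ρ.rOut + L * ‖z - y‖)) := by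
      refine norm_integral_le_of_norm_le (ρ.integrable_normed.mul_const _)
        (.of_forall fun t => ?_)
      rw [← mul_sub, norm_mul, Real.norm_of_nonneg (ρ.nonneg_normed t)]
      rcases eq_or_ne (ρ.normed volume t) 0 with h0 | h0
      · simp [h0]
      have ht : ‖t‖ < ρ.rOut := by
        have : t ∈ Function.support (ρ.normed volume) := h0
        rwa [ρ.support_normed_eq, mem_ball_zero_iff] at this
      refine mul_le_mul_of_nonneg_left ?_ (ρ.nonneg_normed t)
      have h1 := h (y - t) (z - t)
      rw [sub_sub_sub_cancel_right, abs_sub_comm, norm_sub_rev y z] at h1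
      refine h1.trans (mul_le_mul_of_nonneg_left ?_ (norm_nonneg _))
      -- The slope is needed at the shifted point `y - t`; moving it back to `y` costs at most `L *
      -- ‖t‖`, and the bump vanishes unless `‖t‖ < rOut`.
      have h2 := (abs_le.1 (hw (y - t) y)).2
      rw [sub_sub_cancel_left, norm_neg] at h2
      nlinarith
    rw [integral_sub (hint z) (hint y), ← hval, ← hval, integral_mul_const,
      ρ.integral_normed, one_mul] at hbd
    exact hbd
  -- Near `y` the second-order error `L * ‖z - y‖ ^ 2` is at most `η * ‖z - y‖`, so it does not
  -- enter the derivative.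
  refine le_of_forall_pos_le_add fun η hη => ?_
  refine (hsm.differentiable (by simp) y).hasFDerivAt.le_of_lip'
    (by have := hw0 y; positivity) ?_
  have hcont : Continuous fun z : Eu k => L * ‖z - y‖ := by fun_prop
  have h3 : ∀ᶠ z in 𝓝 y, L * ‖z - y‖ < η := by
    refine hcont.continuousAt.eventually_lt_const ?_
    simpa using hη
  filter_upwards [h3] with z hz
  refine (key z).trans ?_
  rw [mul_comm]
  gcongr

/-- A compactly supported potential whose slope is at most `w` bounds the weighted mass
`∫ w d|E|` of an admissible flux from below. -/
lemma IsAdmissible.sum_le_integral {x : Fin n → Eu k} {lam : Fin n → ℝ} {μ : Measure (Eu k)}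
    {E : VectorMeasure (Eu k) (Eu k)} (hE : IsAdmissible x lam μ E)
    (h : HasSlopeBound u w L) (hc : HasCompactSupport u)
    (hw0 : ∀ y, 0 ≤ w y) (hL : 0 ≤ L) (hw : ∀ y z, |w y - w z| ≤ L * ‖y - z‖) {M : ℝ}
    (hM : ∀ y, w y ≤ M) :
    ∑ i, lam i * u (x i) ≤ ∫ y, w y * ‖fluxDensity μ E y‖ ∂μ := by
  have hf := integrable_fluxDensity μ E
  have hwc := continuous_of_abs_sub_le hw
  have hwi : Integrable (fun y => w y * ‖fluxDensity μ E y‖) μ :=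
    hf.norm.bdd_mul hwc.aestronglyMeasurable
      (.of_forall fun y => (Real.norm_of_nonneg (hw0 y)).trans_le (hM y))
  let ρ (m : ℕ) : ContDiffBump (0 : Eu k) :=
    ⟨1 / ((m : ℝ) + 1) / 2, 1 / ((m : ℝ) + 1), by positivity, half_lt_self (by positivity)⟩
  have hρ : Tendsto (fun m => (ρ m).rOut) atTop (𝓝 0) := tendsto_one_div_add_atTop_nhds_zero_nat
  let φ (m : ℕ) := convolution ((ρ m).normed volume) u (ContinuousLinearMap.lsmul ℝ ℝ) volume
  have hlim (y : Eu k) : Tendsto (fun m => φ m y) atTop (𝓝 (u y)) :=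
    ContDiffBump.convolution_tendsto_right_of_continuous hρ h.continuous y
  have hle (m : ℕ) : ∑ i, lam i * φ m (x i) ≤ (∫ y, w y * ‖fluxDensity μ E y‖ ∂μ)
      + L * (ρ m).rOut * ∫ y, ‖fluxDensity μ E y‖ ∂μ := by
    have hsm : ContDiff ℝ ∞ (φ m) :=
      (ρ m).hasCompactSupport_normed.contDiff_convolution_left (n := ⊤) _ (ρ m).contDiff_normed
        h.continuous.locallyIntegrable
    have hcs : HasCompactSupport (φ m) := (ρ m).hasCompactSupport_normed.convolution _ hc
    rw [hE.sum_eq hsm hcs, ← integral_const_mul, ← integral_add hwi (hf.norm.const_mul _)]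
    refine (neg_le_abs _).trans ?_
    rw [← Real.norm_eq_abs]
    refine norm_integral_le_of_norm_le (hwi.add (hf.norm.const_mul _)) (.of_forall fun y => ?_)
    refine (ContinuousLinearMap.le_opNorm _ _).trans ?_
    have := h.norm_fderiv_convolution_le hw0 hL hw (ρ m) y
    rw [← add_mul]
    gcongr
  refine le_of_tendsto_of_tendsto' (tendsto_finsetSum _ fun i _ => (hlim (x i)).const_mul _) ?_ hle
  simpa using ((hρ.const_mul L).mul_const (∫ y, ‖fluxDensity μ E y‖ ∂μ)).const_add
    (∫ y, w y * ‖fluxDensity μ E y‖ ∂μ)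

end Mollify

/-! ### Perturbed distance functions -/

section Perturbed

variable {k : ℕ}

/-- The average of `ψ` over the segment from `a` to `y`. -/
noncomputable def segAvg (ψ : Eu k → ℝ) (a y : Eu k) : ℝ :=
  ∫ s in (0 : ℝ)..1, ψ (AffineMap.lineMap a y s)

/-- The derivative of `segAvg ψ a` at `y`. -/
noncomputable def segAvgDeriv (ψ : Eu k → ℝ) (a y : Eu k) : Eu k →L[ℝ] ℝ :=
  ∫ s in (0 : ℝ)..1, s • fderiv ℝ ψ (AffineMap.lineMap a y s)

/-- The distance to `a`, measured along straight segments with the weight `1 - t ψ`. -/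
noncomputable def perturbedDist (ψ : Eu k → ℝ) (t : ℝ) (a y : Eu k) : ℝ :=
  ‖y - a‖ * (1 - t * segAvg ψ a y)

variable {ψ : Eu k → ℝ} {M B C t : ℝ} {a : Eu k}

lemma perturbedDist_self : perturbedDist ψ t a a = 0 := by simp [perturbedDist]

lemma continuous_lineMap_param (a y : Eu k) : Continuous fun s : ℝ => AffineMap.lineMap a y s := by
  simp only [AffineMap.lineMap_apply, vsub_eq_sub, vadd_eq_add]
  fun_prop

lemma abs_segAvg_sub_le (hψ : Continuous ψ) {y : Eu k} {c K : ℝ}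
    (h : ∀ s ∈ Icc (0 : ℝ) 1, |ψ (AffineMap.lineMap a y s) - c| ≤ K) :
    |segAvg ψ a y - c| ≤ K := by
  have hi : IntervalIntegrable (fun s : ℝ => ψ (AffineMap.lineMap a y s)) volume 0 1 :=
    (hψ.comp (continuous_lineMap_param a y)).intervalIntegrable _ _
  have h1 : segAvg ψ a y - c = ∫ s in (0 : ℝ)..1, (ψ (AffineMap.lineMap a y s) - c) := by
    rw [intervalIntegral.integral_sub hi (by simp)]
    simp [segAvg]
  rw [h1, ← Real.norm_eq_abs]
  refine (intervalIntegral.norm_integral_le_of_norm_le_const (C := K) fun s hs => ?_).trans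
    (by simp)
  rw [uIoc_of_le zero_le_one] at hs
  exact h s ⟨hs.1.le, hs.2⟩

lemma abs_sub_le_of_norm_fderiv_le (hψ : ContDiff ℝ ∞ ψ) (hM : ∀ z, ‖fderiv ℝ ψ z‖ ≤ M)
    (y z : Eu k) : |ψ y - ψ z| ≤ M * ‖y - z‖ := by
  rw [← Real.norm_eq_abs]
  exact convex_univ.norm_image_sub_le_of_norm_fderiv_le
    (fun p _ => hψ.differentiable (by simp) p) (fun p _ => hM p) (mem_univ z) (mem_univ y)

lemma abs_segAvg_sub_left_le (hψ : ContDiff ℝ ∞ ψ) (hM : ∀ z, ‖fderiv ℝ ψ z‖ ≤ M) (y : Eu k) :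
    |segAvg ψ a y - ψ a| ≤ M * ‖y - a‖ := by
  have hM0 : 0 ≤ M := (norm_nonneg _).trans (hM 0)
  refine abs_segAvg_sub_le hψ.continuous fun s hs =>
    (abs_sub_le_of_norm_fderiv_le hψ hM _ _).trans (mul_le_mul_of_nonneg_left ?_ hM0)
  rw [← dist_eq_norm, dist_lineMap_left, Real.norm_of_nonneg hs.1, dist_comm, dist_eq_norm]
  exact mul_le_of_le_one_left (norm_nonneg _) hs.2

lemma abs_segAvg_sub_right_le (hψ : ContDiff ℝ ∞ ψ) (hM : ∀ z, ‖fderiv ℝ ψ z‖ ≤ M) (y : Eu k) :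
    |segAvg ψ a y - ψ y| ≤ M * ‖y - a‖ := by
  have hM0 : 0 ≤ M := (norm_nonneg _).trans (hM 0)
  refine abs_segAvg_sub_le hψ.continuous fun s hs =>
    (abs_sub_le_of_norm_fderiv_le hψ hM _ _).trans (mul_le_mul_of_nonneg_left ?_ hM0)
  rw [← dist_eq_norm, dist_lineMap_right, Real.norm_of_nonneg (by linarith [hs.2]), dist_comm,
    dist_eq_norm]
  exact mul_le_of_le_one_left (norm_nonneg _) (by linarith [hs.1])

lemma hasFDerivAt_lineMap_right (a y : Eu k) (s : ℝ) :
    HasFDerivAt (fun z => AffineMap.lineMap a z s) (s • ContinuousLinearMap.id ℝ (Eu k)) y := by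
  simp only [AffineMap.lineMap_apply, vsub_eq_sub, vadd_eq_add]
  exact (((hasFDerivAt_id y).sub_const a).const_smul s).add_const a

lemma hasFDerivAt_segAvg (hψ : ContDiff ℝ ∞ ψ) (hM : ∀ z, ‖fderiv ℝ ψ z‖ ≤ M) (y : Eu k) :
    HasFDerivAt (segAvg ψ a) (segAvgDeriv ψ a y) y := by
  have hd : Continuous (fderiv ℝ ψ) := hψ.continuous_fderiv (by simp)
  refine (intervalIntegral.hasFDerivAt_integral_of_dominated_of_fderiv_le (𝕜 := ℝ)
    (F := fun z s => ψ (AffineMap.lineMap a z s))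
    (F' := fun z s => s • fderiv ℝ ψ (AffineMap.lineMap a z s)) (bound := fun _ => M)
    (s := univ) Filter.univ_mem ?_ ?_ ?_ ?_ ?_ ?_)
  · exact .of_forall fun z =>
      (hψ.continuous.comp (continuous_lineMap_param a z)).aestronglyMeasurable
  · exact (hψ.continuous.comp (continuous_lineMap_param a y)).intervalIntegrable _ _
  · exact (continuous_id.smul (hd.comp (continuous_lineMap_param a y))).aestronglyMeasurable
  · refine .of_forall fun s hs z _ => ?_
    rw [uIoc_of_le zero_le_one] at hs
    rw [norm_smul, Real.norm_of_nonneg hs.1.le]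
    exact (mul_le_of_le_one_left (norm_nonneg _) hs.2).trans (hM _)
  · simp
  · refine .of_forall fun s _ z _ => ?_
    have h := ((hψ.differentiable (by simp)
      (AffineMap.lineMap a z s)).hasFDerivAt).comp z (hasFDerivAt_lineMap_right a z s)
    refine h.congr_fderiv ?_
    ext v
    simp

lemma intervalIntegrable_segAvgDeriv (hψ : ContDiff ℝ ∞ ψ) (y : Eu k) :
    IntervalIntegrable (fun s : ℝ => s • fderiv ℝ ψ (AffineMap.lineMap a y s)) volume 0 1 :=
  (continuous_id.smul ((hψ.continuous_fderiv (by simp)).comp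
    (continuous_lineMap_param a y))).intervalIntegrable _ _

/-- The derivative of `r ↦ r * segAvg ψ a (a + r e)` is `ψ (a + r e)`. -/
lemma segAvg_add_segAvgDeriv (hψ : ContDiff ℝ ∞ ψ) (y : Eu k) :
    segAvg ψ a y + segAvgDeriv ψ a y (y - a) = ψ y := by
  have hd : Continuous (fderiv ℝ ψ) := hψ.continuous_fderiv (by simp)
  have hl := continuous_lineMap_param a y
  have h1 : segAvgDeriv ψ a y (y - a)
      = ∫ s in (0 : ℝ)..1, s * fderiv ℝ ψ (AffineMap.lineMap a y s) (y - a) := by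
    rw [segAvgDeriv, ContinuousLinearMap.intervalIntegral_apply
      (intervalIntegrable_segAvgDeriv hψ y)]
    simp
  have c1 : Continuous fun s : ℝ => ψ (AffineMap.lineMap a y s) := hψ.continuous.comp hl
  have c2 : Continuous fun s : ℝ => s * fderiv ℝ ψ (AffineMap.lineMap a y s) (y - a) :=
    continuous_id.mul ((hd.comp hl).clm_apply continuous_const)
  rw [segAvg, h1, ← intervalIntegral.integral_add (c1.intervalIntegrable _ _)
    (c2.intervalIntegrable _ _)]
  -- The combined integrand is the derivative of `s * ψ (lineMap a y s)`, whose end values are `0`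
  -- and `ψ y`.
  have hder (s : ℝ) : HasDerivAt (fun s : ℝ => s * ψ (AffineMap.lineMap a y s))
      (ψ (AffineMap.lineMap a y s) + s * fderiv ℝ ψ (AffineMap.lineMap a y s) (y - a)) s := by
    have h2 : HasDerivAt (fun s : ℝ => AffineMap.lineMap a y s) (y - a) s := by
      simpa using (AffineMap.hasDerivAt_lineMap (a := a) (b := y) (x := s))
    have h3 := (hψ.differentiable (by simp) (AffineMap.lineMap a y s)).hasFDerivAt.comp_hasDerivAt
      s h2
    exact ((hasDerivAt_id s).mul h3).congr_deriv (by simp)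
  rw [intervalIntegral.integral_eq_sub_of_hasDerivAt (fun s _ => hder s)
    ((c1.add c2).intervalIntegrable _ _)]
  simp

/-- The point at parameter `s` lies at distance `s * ‖y - a‖` from `a`, so the factor `s` in
`segAvgDeriv` lets `hC` bound the integrand uniformly in `y`. -/
lemma norm_mul_norm_segAvgDeriv_le (hC : ∀ z, ‖z - a‖ * ‖fderiv ℝ ψ z‖ ≤ C) (y : Eu k) :
    ‖y - a‖ * ‖segAvgDeriv ψ a y‖ ≤ C := by
  have h1 : ‖y - a‖ * ‖segAvgDeriv ψ a y‖
      = ‖∫ s in (0 : ℝ)..1, ‖y - a‖ • s • fderiv ℝ ψ (AffineMap.lineMap a y s)‖ := by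
    rw [intervalIntegral.integral_smul, norm_smul, norm_norm, segAvgDeriv]
  rw [h1]
  refine (intervalIntegral.norm_integral_le_of_norm_le_const (C := C) fun s hs => ?_).trans
    (by simp)
  rw [uIoc_of_le zero_le_one] at hs
  have h2 : ‖(AffineMap.lineMap a y s : Eu k) - a‖ = s * ‖y - a‖ := by
    rw [← dist_eq_norm, dist_lineMap_left, Real.norm_of_nonneg hs.1.le, dist_comm, dist_eq_norm]
  have h3 := hC (AffineMap.lineMap a y s)
  rw [h2] at h3
  rw [norm_smul, norm_smul, norm_norm, Real.norm_of_nonneg hs.1.le]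
  linarith

lemma hasFDerivAt_norm_sub {y : Eu k} (h : y ≠ a) :
    HasFDerivAt (fun z => ‖z - a‖) (‖y - a‖⁻¹ • innerSL ℝ (y - a)) y := by
  have h0 : ‖y - a‖ ≠ 0 := norm_ne_zero_iff.2 (sub_ne_zero.2 h)
  have h1 := (((hasFDerivAt_id y).sub_const a).norm_sq).sqrt (pow_ne_zero 2 h0)
  simp only [id, Real.sqrt_sq (norm_nonneg _)] at h1
  refine h1.congr_fderiv ?_
  ext v
  simp
  field_simp

/-- Away from `a` the slope of the perturbed distance exceeds `1 - t ψ`, its radial derivative,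
by a term of second order in `t` only. -/
lemma exists_hasFDerivAt_perturbedDist (hψ : ContDiff ℝ ∞ ψ) (hM : ∀ z, ‖fderiv ℝ ψ z‖ ≤ M)
    (hC : ∀ z, ‖z - a‖ * ‖fderiv ℝ ψ z‖ ≤ C) {y : Eu k} (hy : y ≠ a) (ht : 0 ≤ t)
    (hB : t * ψ y ≤ 1 / 2) :
    ∃ D : Eu k →L[ℝ] ℝ, HasFDerivAt (perturbedDist ψ t a) D y ∧
      ‖D‖ ≤ 1 - t * ψ y + t ^ 2 * C ^ 2 := by
  have h0 : 0 < ‖y - a‖ := norm_pos_iff.2 (sub_ne_zero.2 hy)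
  have hC0 : 0 ≤ C := (by positivity : 0 ≤ ‖a - a‖ * ‖fderiv ℝ ψ a‖).trans (hC a)
  refine ⟨_, (hasFDerivAt_norm_sub hy).mul
    (((hasFDerivAt_segAvg (a := a) hψ hM y).const_mul t).const_sub 1), ?_⟩
  refine ContinuousLinearMap.opNorm_le_bound _ (by nlinarith [sq_nonneg (t * C)]) fun v => ?_
  set r := ‖y - a‖ with hr
  set G := segAvgDeriv ψ a y
  -- Split `v` into its radial coordinate `α` and the orthogonal part `w`. By
  -- `segAvg_add_segAvgDeriv` the radial part contributes exactly `α * (1 - t * ψ y)`; the remaining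
  -- term is tangential and of order `t`.
  obtain ⟨α, hα⟩ : ∃ α, α = r⁻¹ * inner ℝ (y - a) v := ⟨_, rfl⟩
  obtain ⟨w, hw⟩ : ∃ w, w = v - (α * r⁻¹) • (y - a) := ⟨_, rfl⟩
  have hrad := segAvg_add_segAvgDeriv (a := a) hψ y
  have hv : v = (α * r⁻¹) • (y - a) + w := by simp [hw]
  have hyy : inner ℝ (y - a) (y - a) = r ^ 2 := by rw [real_inner_self_eq_norm_sq]
  have horth : inner ℝ (y - a) w = 0 := by
    rw [hw, inner_sub_right, inner_smul_right, hyy, hα]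
    field_simp
    ring
  have hpyth : α ^ 2 + ‖w‖ ^ 2 = ‖v‖ ^ 2 := by
    conv_rhs => rw [hv, norm_add_sq_real, inner_smul_left, horth, norm_smul, ← hr]
    simp only [mul_zero, add_zero, norm_mul, norm_inv, Real.norm_eq_abs, mul_pow, sq_abs, inv_pow]
    field_simp
  have hG : G v = (α * r⁻¹) * G (y - a) + G w := by
    conv_lhs => rw [hv]
    simp
  have hexp : (r • -(t • G) + (1 - t * segAvg ψ a y) • r⁻¹ • innerSL ℝ (y - a)) v
      = α * (1 - t * ψ y) - t * (r * G w) := by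
    have : (r • -(t • G) + (1 - t * segAvg ψ a y) • r⁻¹ • innerSL ℝ (y - a)) v
      = r * -(t * G v) + (1 - t * segAvg ψ a y) * α := by
      rw [hα]; rfl
    rw [this, hG, ← hrad]
    field_simp
    ring
  rw [hexp]
  have hGw : |r * G w| ≤ C * ‖w‖ := by
    rw [abs_mul, abs_of_pos h0]
    calc r * |G w| ≤ r * (‖G‖ * ‖w‖) := by gcongr; exact G.le_opNorm w
      _ = (r * ‖G‖) * ‖w‖ := by ring
      _ ≤ C * ‖w‖ := by gcongr; exact norm_mul_norm_segAvgDeriv_le hC y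
  set p := 1 - t * ψ y with hp
  have hp2 : 1 / 2 ≤ p := by linarith
  have h1 : ‖α * p - t * (r * G w)‖ ≤ |α| * p + t * C * ‖w‖ := by
    rw [Real.norm_eq_abs]
    refine (abs_sub _ _).trans ?_
    rw [abs_mul, abs_mul, abs_of_nonneg ht, abs_of_nonneg (by linarith : 0 ≤ p), mul_assoc]
    gcongr
  refine h1.trans (abs_le_of_sq_le_sq' ?_ (by positivity)).2
  rw [← sq_abs α] at hpyth
  rw [mul_pow, ← hpyth]
  -- Cauchy–Schwarz bounds the slope by the square root of `p² + (tC)²`. Since `2p ≥ 1`, this is at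
  -- most `p + (tC)²`: the tangential part costs only second order in `t`.
  have h2 : (|α| * p + t * C * ‖w‖) ^ 2 ≤ (p ^ 2 + (t * C) ^ 2) * (|α| ^ 2 + ‖w‖ ^ 2) := by
    nlinarith [sq_nonneg (|α| * (t * C) - p * ‖w‖)]
  refine h2.trans (mul_le_mul_of_nonneg_right ?_ (by positivity))
  nlinarith [sq_nonneg (t * C), sq_nonneg ((t * C) ^ 2)]

/-- The perturbed distance has slope at most `1 - t ψ + O(t²)`. -/
lemma hasSlopeBound_perturbedDist (hψ : ContDiff ℝ ∞ ψ) (hM : ∀ z, ‖fderiv ℝ ψ z‖ ≤ M)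
    (hC : ∀ z, ‖z - a‖ * ‖fderiv ℝ ψ z‖ ≤ C) (ht : 0 ≤ t) (hB : ∀ z, t * ψ z ≤ 1 / 2) :
    HasSlopeBound (perturbedDist ψ t a) (fun z => 1 - t * ψ z + t ^ 2 * C ^ 2) (t * M) := by
  have hM0 : 0 ≤ M := (norm_nonneg _).trans (hM 0)
  have hw (y z : Eu k) : |t * ψ y - t * ψ z| ≤ t * M * ‖y - z‖ := by
    rw [← mul_sub, abs_mul, abs_of_nonneg ht, mul_assoc]
    exact mul_le_mul_of_nonneg_left (abs_sub_le_of_norm_fderiv_le hψ hM y z) ht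
  have hend {y : Eu k} {c : ℝ} (hc : t * c ≤ 1 / 2) (h : |segAvg ψ a y - c| ≤ M * ‖y - a‖) :
      |perturbedDist ψ t a y| ≤ ‖y - a‖ * (1 - t * c + t ^ 2 * C ^ 2 + t * M * ‖y - a‖) := by
    rw [perturbedDist, abs_mul, abs_norm]
    refine mul_le_mul_of_nonneg_left ?_ (norm_nonneg _)
    have h1 : |t * (segAvg ψ a y - c)| ≤ t * (M * ‖y - a‖) := by
      rw [abs_mul, abs_of_nonneg ht]; gcongr
    have h2 := abs_le.1 h1
    rw [abs_le]
    constructor <;> nlinarith [h2.1, h2.2, sq_nonneg (t * C)]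
  intro y z
  -- The perturbed distance need not be differentiable at `a`. If `a` lies between `y` and `z`, both
  -- values are estimated directly and the distances to `a` add up to `‖y - z‖`; otherwise the mean
  -- value inequality applies along the segment.
  by_cases ha : a ∈ segment ℝ y z
  · have h1 := hend (hB y) (abs_segAvg_sub_right_le hψ hM y)
    have h2 := hend (hB a) (abs_segAvg_sub_left_le hψ hM z)
    have h3 := (abs_le.1 (hw y a)).2
    have h4 : ‖y - a‖ + ‖z - a‖ = ‖y - z‖ := by
      have := dist_add_dist_of_mem_segment ha
      rwa [dist_eq_norm, dist_eq_norm, dist_eq_norm, norm_sub_rev a z] at this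
    refine (abs_sub _ _).trans ((add_le_add h1 h2).trans ?_)
    rw [← h4]
    have hp : 0 ≤ t * M * ‖y - a‖ * ‖z - a‖ := by positivity
    nlinarith [mul_le_mul_of_nonneg_left h3 (norm_nonneg (z - a))]
  · have hne : ∀ p ∈ segment ℝ y z, p ≠ a := fun p hp h => ha (h ▸ hp)
    choose! D hD1 hD2 using fun p (hp : p ∈ segment ℝ y z) =>
      exists_hasFDerivAt_perturbedDist hψ hM hC (hne p hp) ht (hB p)
    have := (convex_segment y z).norm_image_sub_le_of_norm_hasFDerivWithin_le
      (C := 1 - t * ψ y + t ^ 2 * C ^ 2 + t * M * ‖y - z‖)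
      (fun p hp => (hD1 p hp).hasFDerivWithinAt) (fun p hp => (hD2 p hp).trans ?_)
      (right_mem_segment ℝ y z) (left_mem_segment ℝ y z)
    · rw [Real.norm_eq_abs] at this
      linarith
    · have h1 := (abs_le.1 (hw y p)).2
      have h2 : ‖y - p‖ ≤ ‖y - z‖ := by
        have := dist_add_dist_of_mem_segment hp
        rw [dist_eq_norm, dist_eq_norm, dist_eq_norm] at this
        linarith [norm_nonneg (p - z)]
      have h3 : t * M * ‖y - p‖ ≤ t * M * ‖y - z‖ := by gcongr
      linarith

/-- Coercivity, which gives the truncated potentials in `IsAdmissible.dual_le_integral` compact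
support. -/
lemma half_norm_le_perturbedDist (hψ : ContDiff ℝ ∞ ψ) (ht : 0 ≤ t)
    (hB : ∀ z, t * |ψ z| ≤ 1 / 2) (y : Eu k) : ‖y - a‖ / 2 ≤ perturbedDist ψ t a y := by
  have h1 : t * segAvg ψ a y ≤ 1 / 2 := by
    rcases ht.eq_or_lt with rfl | ht'
    · norm_num
    have := abs_segAvg_sub_le (a := a) (y := y) (c := 0) (K := 1 / 2 / t) hψ.continuous
      fun s _ => by rw [sub_zero, le_div_iff₀ ht', mul_comm]; exact hB _
    rw [sub_zero, le_div_iff₀ ht'] at this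
    nlinarith [le_abs_self (segAvg ψ a y)]
  rw [perturbedDist]
  nlinarith [norm_nonneg (y - a)]

end Perturbed

/-! ### Transport plans and linear programming duality -/

section Plans

variable {n : ℕ} {lam : Fin n → ℝ}

lemma sum_source_add_sum_sink (lam g : Fin n → ℝ) :
    ∑ i : Source lam, lam i * g i + ∑ j : Sink lam, lam j * g j = ∑ i, lam i * g i := by
  classical
  rw [← Finset.sum_subtype (Finset.univ.filter fun i => 0 < lam i) (by simp)
      (fun i => lam i * g i),
    ← Finset.sum_subtype (Finset.univ.filter fun i => lam i < 0) (by simp)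
      (fun i => lam i * g i), Finset.sum_filter, Finset.sum_filter, ← Finset.sum_add_distrib]
  refine Finset.sum_congr rfl fun i _ => ?_
  rcases lt_trichotomy (lam i) 0 with h | h | h
  · simp [h, not_lt.2 h.le]
  · simp [h]
  · simp [h, not_lt.2 h.le]

lemma sum_sink_neg (hlam : ∑ i, lam i = 0) :
    ∑ j : Sink lam, -lam j = ∑ i : Source lam, lam i := by
  have := sum_source_add_sum_sink lam 1
  simp only [Pi.one_apply, mul_one, hlam] at this
  rw [Finset.sum_neg_distrib]
  linarith

lemma nonempty_source (hlam : ∑ i, lam i = 0) (h0 : lam ≠ 0) : Nonempty (Source lam) := by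
  by_contra hcon
  rw [not_nonempty_iff] at hcon
  have hle : ∀ i, lam i ≤ 0 := fun i => not_lt.1 fun h => hcon.false ⟨i, h⟩
  exact h0 (funext fun i =>
    (Finset.sum_eq_zero_iff_of_nonpos fun i _ => hle i).1 hlam i (Finset.mem_univ i))

lemma sum_source_pos [Nonempty (Source lam)] : 0 < ∑ i : Source lam, lam i :=
  Finset.sum_pos (fun i _ => i.2) Finset.univ_nonempty

/-- The plan that splits every source proportionally to the demands of the sinks. -/
lemma product_mem_plans (hlam : ∑ i, lam i = 0) [Nonempty (Source lam)] :
    (Matrix.of fun (i : Source lam) (j : Sink lam) =>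
      lam i * -lam j / ∑ i : Source lam, lam i) ∈ plans lam := by
  have hM := sum_source_pos (lam := lam)
  refine ⟨fun i j => ?_, fun i => ?_, fun j => ?_⟩
  · exact div_nonneg (mul_nonneg i.2.le (by linarith [j.2])) hM.le
  · simp only [Matrix.of_apply]
    rw [← Finset.sum_div, ← Finset.mul_sum, sum_sink_neg hlam]
    field_simp
  · simp only [Matrix.of_apply]
    rw [← Finset.sum_div, ← Finset.sum_mul]
    field_simp

lemma plans_nonempty (hlam : ∑ i, lam i = 0) : (plans lam).Nonempty := by
  by_cases h0 : lam = 0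
  · subst h0
    exact ⟨0, fun i => absurd i.2 (by simp), fun i => absurd i.2 (by simp),
      fun j => absurd j.2 (by simp)⟩
  · have := nonempty_source hlam h0
    exact ⟨_, product_mem_plans hlam⟩

lemma plans_le {A : Matrix (Source lam) (Sink lam) ℝ} (hA : A ∈ plans lam) (i : Source lam)
    (j : Sink lam) : A i j ≤ lam i := by
  rw [← hA.2.1 i]
  exact Finset.single_le_sum (f := fun j => A i j) (fun j _ => hA.1 i j) (Finset.mem_univ j)

lemma isCompact_plans (lam : Fin n → ℝ) : IsCompact (plans lam) := by
  have hK : IsCompact (univ.pi fun i : Source lam => univ.pi fun _ : Sink lam =>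
      Icc (0 : ℝ) (lam i)) :=
    isCompact_univ_pi fun i => isCompact_univ_pi fun j => isCompact_Icc
  refine IsCompact.of_isClosed_subset (s := (univ.pi fun i : Source lam =>
    univ.pi fun _ : Sink lam => Icc (0 : ℝ) (lam i) : Set (Matrix (Source lam) (Sink lam) ℝ)))
    hK ?_ ?_
  · have hc (i : Source lam) (j : Sink lam) :
        Continuous fun A : Matrix (Source lam) (Sink lam) ℝ => A i j :=
      continuous_id.matrix_elem i j
    simp only [plans, ofPred_and, ofPred_forall]
    refine IsClosed.inter ?_ (IsClosed.inter ?_ ?_)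
    · exact isClosed_iInter fun i => isClosed_iInter fun j =>
        isClosed_le continuous_const (hc i j)
    · exact isClosed_iInter fun i =>
        isClosed_eq (continuous_finsetSum _ fun j _ => hc i j) continuous_const
    · exact isClosed_iInter fun j =>
        isClosed_eq (continuous_finsetSum _ fun i _ => hc i j) continuous_const
  · exact fun A hA i _ j _ => ⟨hA.1 i j, plans_le hA i j⟩

lemma convex_plans (lam : Fin n → ℝ) : Convex ℝ (plans lam) := by
  intro A hA B hB s t hs ht hst
  refine ⟨fun i j => ?_, fun i => ?_, fun j => ?_⟩
  · have := hA.1 i j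
    have := hB.1 i j
    simp only [Matrix.add_apply, Matrix.smul_apply, smul_eq_mul]
    positivity
  · simp only [Matrix.add_apply, Matrix.smul_apply, smul_eq_mul]
    rw [Finset.sum_add_distrib, ← Finset.mul_sum, ← Finset.mul_sum, hA.2.1, hB.2.1, ← add_mul,
      hst, one_mul]
  · simp only [Matrix.add_apply, Matrix.smul_apply, smul_eq_mul]
    rw [Finset.sum_add_distrib, ← Finset.mul_sum, ← Finset.mul_sum, hA.2.2, hB.2.2, ← add_mul,
      hst, one_mul]

/-- The total cost of a plan for the unit costs `c`. -/
noncomputable def planCost (c : Source lam → Sink lam → ℝ) (A : Matrix (Source lam) (Sink lam) ℝ) : ℝ :=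
  ∑ i, ∑ j, A i j * c i j

lemma continuous_planCost (c : Source lam → Sink lam → ℝ) : Continuous (planCost c) :=
  continuous_finsetSum _ fun i _ => continuous_finsetSum _ fun j _ =>
    (continuous_id.matrix_elem i j).mul continuous_const

lemma planCost_add_smul (c : Source lam → Sink lam → ℝ) (s t : ℝ)
    (A B : Matrix (Source lam) (Sink lam) ℝ) :
    planCost c (s • A + t • B) = s * planCost c A + t * planCost c B := by
  simp only [planCost, Matrix.add_apply, Matrix.smul_apply, smul_eq_mul, add_mul,
    Finset.sum_add_distrib, Finset.mul_sum, mul_assoc]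

/-- Linear programming duality for the transport problem. -/
lemma exists_planCost_le (hlam : ∑ i, lam i = 0) [Nonempty (Source lam)]
    (c : Source lam → Sink lam → ℝ) (V : ℝ)
    (h : ∀ (a : Source lam → ℝ) (b : Sink lam → ℝ), (∀ i j, a i + b j ≤ c i j) →
      ∑ i : Source lam, lam i * a i + ∑ j : Sink lam, -lam j * b j ≤ V) :
    ∃ A ∈ plans lam, planCost c A ≤ V := by
  classical
  by_contra! hcon
  set m := ∑ i : Source lam, lam i with hm
  have hm0 : 0 < m := sum_source_pos
  -- Plans have total mass `m` and the simplex has mass one, hence the factor. `T` records both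
  -- marginals and the cost, so a point of its image in the set below is a plan of cost at most `V`.
  let T : (Source lam × Sink lam → ℝ) → (Source lam → ℝ) × (Sink lam → ℝ) × ℝ := fun p =>
    (fun i => ∑ j, m * p (i, j), fun j => ∑ i, m * p (i, j), ∑ i, ∑ j, m * p (i, j) * c i j)
  have hT : IsLinearMap ℝ T := by
    constructor
    · intro p q
      simp only [T, Pi.add_apply, mul_add, add_mul, Finset.sum_add_distrib]
      rfl
    · intro r p
      simp only [T, Pi.smul_apply, smul_eq_mul, Prod.smul_mk, Finset.mul_sum]
      refine Prod.ext (funext fun i => ?_) (Prod.ext (funext fun j => ?_) ?_)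
      · simp only [Pi.smul_apply, smul_eq_mul, Finset.mul_sum, mul_left_comm m r]
      · simp only [Pi.smul_apply, smul_eq_mul, Finset.mul_sum, mul_left_comm m r]
      · simp only [mul_left_comm m r, mul_assoc]
  have hTc : Continuous T := by fun_prop
  have hdisj : Disjoint (T '' stdSimplex ℝ (Source lam × Sink lam))
      ({fun i : Source lam => lam i} ×ˢ {fun j : Sink lam => -lam j} ×ˢ Iic V) := by
    rw [Set.disjoint_left]
    rintro _ ⟨p, hp, rfl⟩ ⟨h1, h2, h3⟩
    refine (hcon (Matrix.of fun i j => m * p (i, j)) ⟨fun i j => mul_nonneg hm0.le (hp.1 _),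
      fun i => congrFun h1 i, fun j => congrFun h2 j⟩).not_ge h3
  obtain ⟨f, u, v, hu, huv, hv⟩ := geometric_hahn_banach_compact_closed
    ((convex_stdSimplex ℝ _).is_linear_image hT) ((isCompact_stdSimplex ℝ _).image hTc)
    ((convex_singleton _).prod ((convex_singleton _).prod (convex_Iic V)))
    (isClosed_singleton.prod (isClosed_singleton.prod isClosed_Iic)) hdisj
  let a : Source lam → ℝ := fun i => f (Pi.single i 1, 0, 0)
  let b : Sink lam → ℝ := fun j => f (0, Pi.single j 1, 0)
  let g : ℝ := f (0, 0, 1)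
  have hf (p : Source lam → ℝ) (q : Sink lam → ℝ) (r : ℝ) :
      f (p, q, r) = ∑ i, p i * a i + ∑ j, q j * b j + r * g := by
    have h1 : (p, q, r) = ∑ i, p i • ((Pi.single i 1, 0, 0) : (Source lam → ℝ) × (Sink lam → ℝ) × ℝ)
        + ∑ j, q j • ((0, Pi.single j 1, 0) : (Source lam → ℝ) × (Sink lam → ℝ) × ℝ)
        + r • ((0, 0, 1) : (Source lam → ℝ) × (Sink lam → ℝ) × ℝ) := by
      refine Prod.ext ?_ (Prod.ext ?_ ?_)
      · ext i; simp [Prod.fst_sum, Finset.sum_apply, Pi.single_apply]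
      · ext j; simp [Prod.fst_sum, Prod.snd_sum, Finset.sum_apply, Pi.single_apply]
      · simp [Prod.snd_sum]
    rw [h1]
    simp only [map_add, map_sum, map_smul, smul_eq_mul, a, b, g]
  have hvV (r : ℝ) (hr : r ≤ V) :
      v < ∑ i : Source lam, lam i * a i + ∑ j : Sink lam, -lam j * b j + r * g := by
    rw [← hf]
    exact hv _ ⟨rfl, rfl, hr⟩
  set S := ∑ i : Source lam, lam i * a i + ∑ j : Sink lam, -lam j * b j with hS
  -- The vertices of the simplex give the dual constraints.
  have hunit (i : Source lam) (j : Sink lam) : m * (a i + b j + c i j * g) < u := by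
    have h1 := hu _ ⟨Pi.single (i, j) 1, single_mem_stdSimplex ℝ (i, j), rfl⟩
    rw [hf] at h1
    convert h1 using 1
    simp [Pi.single_apply, Prod.ext_iff, ite_and, mul_assoc]
    ring
  have hprod := product_mem_plans hlam
  -- The product plan has the right marginals and cost above `V`. Separation of its image from the
  -- point with the same marginals and cost `V` fixes the sign of `g`, so that one may divide by
  -- `-g`.
  have hg : g < 0 := by
    set A := Matrix.of fun (i : Source lam) (j : Sink lam) => lam i * -lam j / m with hA
    have h1 := hu _ ⟨fun p => A p.1 p.2 / m, ⟨fun p => div_nonneg (hprod.1 _ _) hm0.le, by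
      rw [Fintype.sum_prod_type]
      simp_rw [← Finset.sum_div]
      rw [Finset.sum_congr rfl fun i _ => hprod.2.1 i, ← hm, div_self hm0.ne']⟩, rfl⟩
    have h2 : T (fun p => A p.1 p.2 / m)
        = (fun i : Source lam => lam i, fun j : Sink lam => -lam j, planCost c A) := by
      simp only [T, mul_div_cancel₀ _ hm0.ne']
      exact Prod.ext (funext fun i => hprod.2.1 i) (Prod.ext (funext fun j => hprod.2.2 j) rfl)
    rw [h2, hf] at h1
    have h3 := hvV V le_rfl
    have h4 := hcon A hprod
    nlinarith
  -- Absorbing `u / m` into the source potential makes the pair dual feasible; its value `(S - u) /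
  -- -g` exceeds `V` because `u < v < S + V * g`.
  have hdual := h (fun i => (a i - u / m) / -g) (fun j => b j / -g) fun i j => by
    have h1 := hunit i j
    rw [← add_div, div_le_iff₀ (by linarith)]
    rw [← lt_div_iff₀' hm0] at h1
    linarith
  have h1 : ∑ i : Source lam, lam i * ((a i - u / m) / -g) + ∑ j : Sink lam, -lam j * (b j / -g)
      = (S - u) / -g := by
    simp_rw [mul_div_assoc', ← Finset.sum_div, mul_sub]
    rw [← add_div, Finset.sum_sub_distrib, ← Finset.sum_mul, ← hm, hS, mul_div_cancel₀ _ hm0.ne']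
    ring
  rw [h1, div_le_iff₀ (by linarith)] at hdual
  linarith [hvV V le_rfl]

end Plans

/-! ### The perturbed transport problem bounds the weighted mass of a flux -/

section Lower

open Filter Topology

variable {k n : ℕ} {x : Fin n → Eu k} {lam : Fin n → ℝ} {μ : Measure (Eu k)}
  {E : VectorMeasure (Eu k) (Eu k)} {ψ : Eu k → ℝ} {M C t : ℝ}

/-- The two-point form of the slope bound survives maxima, where differentiability may fail. -/
lemma HasSlopeBound.sup {u v w : Eu k → ℝ} {L : ℝ} (hu : HasSlopeBound u w L)
    (hv : HasSlopeBound v w L) : HasSlopeBound (u ⊔ v) w L := fun y z =>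
  (abs_max_sub_max_le_max _ _ _ _).trans (max_le (hu y z) (hv y z))

lemma HasSlopeBound.const_sub {u w : Eu k → ℝ} {L : ℝ} (hu : HasSlopeBound u w L) (c : ℝ) :
    HasSlopeBound (fun y => c - u y) w L := fun y z => by
  rw [sub_sub_sub_cancel_left, abs_sub_comm]
  exact hu y z

lemma hasSlopeBound_const {w : Eu k → ℝ} {L : ℝ} (hw : ∀ y, 0 ≤ w y) (hL : 0 ≤ L) (c : ℝ) :
    HasSlopeBound (fun _ => c) w L := fun y z => by
  have := hw y
  rw [sub_self, abs_zero]
  positivity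

/-- Dual potentials of the transport problem with the perturbed costs bound the weighted mass of
an admissible flux from below. -/
lemma IsAdmissible.dual_le_integral (hE : IsAdmissible x lam μ E) (hlam : ∑ i, lam i = 0)
    [Nonempty (Source lam)] (hψ : ContDiff ℝ ∞ ψ)
    (hM : ∀ z, ‖fderiv ℝ ψ z‖ ≤ M) (hC : ∀ i z, ‖z - x i‖ * ‖fderiv ℝ ψ z‖ ≤ C) (ht : 0 ≤ t)
    (hB : ∀ z, t * |ψ z| ≤ 1 / 2) (a : Source lam → ℝ) (b : Sink lam → ℝ)
    (hab : ∀ i j, a i + b j ≤ perturbedDist ψ t (x i) (x j)) :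
    ∑ i : Source lam, lam i * a i + ∑ j : Sink lam, -lam j * b j
      ≤ ∫ y, (1 - t * ψ y + t ^ 2 * C ^ 2) * ‖fluxDensity μ E y‖ ∂μ := by
  have hM0 : 0 ≤ M := (norm_nonneg _).trans (hM 0)
  have hψt (z : Eu k) : |t * ψ z| ≤ 1 / 2 := by rw [abs_mul, abs_of_nonneg ht]; exact hB z
  -- Raising the source potentials by `K` and lowering the sink potentials by `K` keeps the dual
  -- value, since supply equals demand. With `b j ≤ K`, truncation at `0` respects the bound `K - b
  -- j` at the sinks.
  obtain ⟨K, hK⟩ : ∃ K, ∀ j, b j ≤ K :=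
    ⟨∑ j, |b j|, fun j => (le_abs_self _).trans
      (Finset.single_le_sum (f := fun j => |b j|) (fun _ _ => abs_nonneg _) (Finset.mem_univ j))⟩
  set w : Eu k → ℝ := fun z => 1 - t * ψ z + t ^ 2 * C ^ 2 with hw
  have hw0 (z : Eu k) : 0 ≤ w z := by
    nlinarith [(abs_le.1 (hψt z)).2, sq_nonneg (t * C)]
  -- One cone of slope at most `w` per source, cut off at `0` for compact support. At a sink the
  -- dual constraint bounds every cone by `K - b j`.
  let v : Source lam → Eu k → ℝ := fun i =>
    (fun _ => (0 : ℝ)) ⊔ fun y => a i + K - perturbedDist ψ t (x i) y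
  let u : Eu k → ℝ := Finset.univ.sup' Finset.univ_nonempty v
  have hv (i : Source lam) : HasSlopeBound (v i) w (t * M) ∧ HasCompactSupport (v i) := by
    refine ⟨(hasSlopeBound_const hw0 (by positivity) 0).sup
      ((hasSlopeBound_perturbedDist hψ hM (hC i) ht
        fun z => (le_abs_self _).trans (hψt z)).const_sub _), ?_⟩
    refine HasCompactSupport.intro (isCompact_closedBall (x i) (2 * |a i + K|)) fun y hy => ?_
    rw [Metric.mem_closedBall, dist_eq_norm, not_le] at hy
    have h1 := half_norm_le_perturbedDist (a := x i) hψ ht hB y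
    have h2 := le_abs_self (a i + K)
    exact max_eq_left (by linarith)
  have hu : HasSlopeBound u w (t * M) ∧ HasCompactSupport u :=
    Finset.sup'_induction (p := fun u => HasSlopeBound u w (t * M) ∧ HasCompactSupport u) _ _
      (fun _ h₁ _ h₂ => ⟨h₁.1.sup h₂.1, h₁.2.sup h₂.2⟩) fun i _ => hv i
  have hsource (i : Source lam) : a i + K ≤ u (x i) := by
    have h1 : v i ≤ u := Finset.le_sup' v (Finset.mem_univ i)
    refine le_trans ?_ (h1 (x i))
    have h2 : a i + K - perturbedDist ψ t (x i) (x i) ≤ v i (x i) := le_max_right _ _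
    rwa [perturbedDist_self, sub_zero] at h2
  have hsink (j : Sink lam) : u (x j) ≤ K - b j := by
    rw [show u (x j) = Finset.univ.sup' Finset.univ_nonempty fun i => v i (x j) from
      Finset.sup'_apply _ _ _]
    refine Finset.sup'_le _ _ fun i _ => max_le ?_ ?_
    · linarith [hK j]
    · linarith [hab i j]
  have hmain := hE.sum_le_integral hu.1 hu.2 hw0 (by positivity) (fun y z => by
    rw [hw]
    have h1 := abs_sub_le_of_norm_fderiv_le hψ hM z y
    have h2 : |t * (ψ z - ψ y)| ≤ t * (M * ‖z - y‖) := by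
      rw [abs_mul, abs_of_nonneg ht]; gcongr
    rw [norm_sub_rev, mul_assoc]
    refine (le_of_eq ?_).trans h2
    congr 1
    ring) (M := 3 / 2 + t ^ 2 * C ^ 2) fun y => by
      have := (abs_le.1 (hψt y)).1
      rw [hw]
      simp only
      linarith
  refine le_trans ?_ hmain
  rw [← sum_source_add_sum_sink lam fun i => u (x i)]
  have h1 : ∑ i : Source lam, lam i * (a i + K) ≤ ∑ i : Source lam, lam i * u (x i) :=
    Finset.sum_le_sum fun i _ => mul_le_mul_of_nonneg_left (hsource i) i.2.le
  have h2 : ∑ j : Sink lam, lam j * (K - b j) ≤ ∑ j : Sink lam, lam j * u (x j) :=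
    Finset.sum_le_sum fun j _ => mul_le_mul_of_nonpos_left (hsink j) j.2.le
  have h3 := sum_sink_neg hlam
  have h4 : ∑ i : Source lam, lam i * (a i + K)
      = ∑ i : Source lam, lam i * a i + (∑ i : Source lam, lam i) * K := by
    simp only [mul_add, Finset.sum_add_distrib, Finset.sum_mul]
  have h5 : ∑ j : Sink lam, lam j * (K - b j)
      = ∑ j : Sink lam, -lam j * b j - (∑ j : Sink lam, -lam j) * K := by
    rw [Finset.sum_mul, ← Finset.sum_sub_distrib]
    exact Finset.sum_congr rfl fun j _ => by ring
  rw [h3] at h5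
  linarith

/-- For small `t` some plan has perturbed cost at most `∫ (1 - t ψ) d|E| + O(t²)`. -/
lemma IsAdmissible.exists_planCost_le (hE : IsAdmissible x lam μ E) (hlam : ∑ i, lam i = 0)
    [Nonempty (Source lam)] (hψ : ContDiff ℝ ∞ ψ) (hc : HasCompactSupport ψ) :
    ∃ C, ∃ δ > 0, ∀ t, 0 ≤ t → t ≤ δ → ∃ A ∈ plans lam,
      planCost (fun i j => perturbedDist ψ t (x i) (x j)) A
        ≤ ∫ y, (1 - t * ψ y + t ^ 2 * C ^ 2) * ‖fluxDensity μ E y‖ ∂μ := by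
  have hd : Continuous (fderiv ℝ ψ) := hψ.continuous_fderiv (by simp)
  obtain ⟨M, hM⟩ := (hc.fderiv (𝕜 := ℝ)).exists_bound_of_continuous hd
  obtain ⟨B, hB⟩ := hc.exists_bound_of_continuous hψ.continuous
  have hC (i : Fin n) : ∃ C, ∀ z, ‖z - x i‖ * ‖fderiv ℝ ψ z‖ ≤ C := by
    have h1 : HasCompactSupport fun z => ‖z - x i‖ * ‖fderiv ℝ ψ z‖ :=
      ((hc.fderiv (𝕜 := ℝ)).norm).mul_left
    obtain ⟨C, hC⟩ := h1.exists_bound_of_continuous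
      ((continuous_id.sub continuous_const).norm.mul hd.norm)
    exact ⟨C, fun z => (le_abs_self _).trans (hC z)⟩
  choose C hC using hC
  have hC0 (i : Fin n) : 0 ≤ C i :=
    (by positivity : 0 ≤ ‖x i - x i‖ * ‖fderiv ℝ ψ (x i)‖).trans (hC i _)
  have hB0 : 0 ≤ B := (norm_nonneg _).trans (hB 0)
  -- The sum is a constant common to all sources; the choice of `δ` ensures `t * |ψ| ≤ 1 / 2`.
  refine ⟨∑ i, C i, 1 / (2 * (B + 1)), by positivity, fun t ht htδ =>
    SteadyFlow.exists_planCost_le hlam _ _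
      (hE.dual_le_integral hlam hψ hM (fun i z => (hC i z).trans
        (Finset.single_le_sum (fun i _ => hC0 i) (Finset.mem_univ i))) ht fun z => ?_)⟩
  have h1 : |ψ z| ≤ B := hB z
  rw [le_div_iff₀ (by positivity)] at htδ
  nlinarith

end Lower

/-! ### Optimal plans and edge measures -/

section Edge

variable {k n : ℕ} {x : Fin n → Eu k} {lam : Fin n → ℝ}

lemma cost_eq_planCost (A : Matrix (Source lam) (Sink lam) ℝ) :
    cost x lam A = planCost (fun i j => dist (x i) (x j)) A := rfl

lemma continuous_cost : Continuous (cost x lam) := continuous_planCost _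

lemma isLeast_wasserstein (x : Fin n → Eu k) (hlam : ∑ i, lam i = 0) :
    IsLeast (cost x lam '' plans lam) (wasserstein x lam) :=
  ((isCompact_plans lam).image continuous_cost).isLeast_sInf ((plans_nonempty hlam).image _)

lemma wasserstein_le (hlam : ∑ i, lam i = 0) {A : Matrix (Source lam) (Sink lam) ℝ}
    (hA : A ∈ plans lam) : wasserstein x lam ≤ cost x lam A :=
  (isLeast_wasserstein x hlam).2 ⟨A, hA, rfl⟩

/-- Optimality becomes a single closed, convex condition on the cost. -/
lemma isOptimalPlan_iff (hlam : ∑ i, lam i = 0) {A : Matrix (Source lam) (Sink lam) ℝ} :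
    IsOptimalPlan x lam A ↔ A ∈ plans lam ∧ cost x lam A ≤ wasserstein x lam := by
  refine and_congr_right fun _ => ⟨fun h => ?_, fun h B hB => h.trans (wasserstein_le hlam hB)⟩
  obtain ⟨B, hB, hBW⟩ := (isLeast_wasserstein x hlam).1
  exact (h B hB).trans hBW.le

lemma IsOptimalPlan.cost_eq (hlam : ∑ i, lam i = 0) {A : Matrix (Source lam) (Sink lam) ℝ}
    (hA : IsOptimalPlan x lam A) : cost x lam A = wasserstein x lam :=
  le_antisymm ((isOptimalPlan_iff hlam).1 hA).2 (wasserstein_le hlam hA.1)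

lemma exists_isOptimalPlan (x : Fin n → Eu k) (hlam : ∑ i, lam i = 0) :
    ∃ A, IsOptimalPlan x lam A := by
  obtain ⟨B, hB, hBW⟩ := (isLeast_wasserstein x hlam).1
  exact ⟨B, (isOptimalPlan_iff hlam).2 ⟨hB, hBW.le⟩⟩

lemma source_ne_sink (i : Source lam) (j : Sink lam) : (i : Fin n) ≠ j := fun h => by
  have h1 := i.2
  have h2 := j.2
  rw [h] at h1
  linarith

lemma wasserstein_pos (hx : Function.Injective x) (hlam : ∑ i, lam i = 0) (h0 : lam ≠ 0) :
    0 < wasserstein x lam := by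
  obtain ⟨i⟩ := nonempty_source hlam h0
  obtain ⟨A, hA⟩ := exists_isOptimalPlan x hlam
  rw [← hA.cost_eq hlam, cost]
  have hnn (i : Source lam) (j : Sink lam) : 0 ≤ A i j * dist (x i) (x j) :=
    mul_nonneg (hA.1.1 i j) dist_nonneg
  have h1 : 0 < ∑ j, A i j := by rw [hA.1.2.1]; exact i.2
  obtain ⟨j, -, hj⟩ := Finset.exists_lt_of_sum_lt
    (by simpa using h1 : ∑ _j : Sink lam, (0 : ℝ) < ∑ j, A i j)
  refine Finset.sum_pos' (fun i _ => Finset.sum_nonneg fun j _ => hnn i j)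
    ⟨i, Finset.mem_univ i, Finset.sum_pos' (fun j _ => hnn i j) ⟨j, Finset.mem_univ j, ?_⟩⟩
  exact mul_pos hj (dist_pos.2 (hx.ne (source_ne_sink i j)))

lemma wasserstein_eq_zero (x : Fin n → Eu k) : wasserstein x (0 : Fin n → ℝ) = 0 := by
  obtain ⟨B, hB, hBW⟩ := (isLeast_wasserstein x (lam := 0) (by simp)).1
  rw [← hBW, cost]
  exact Finset.sum_eq_zero fun i _ => absurd i.2 (by simp)

instance isProbabilityMeasure_uniformOnSegment (a b : Eu k) :
    IsProbabilityMeasure (uniformOnSegment a b) := by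
  have : IsProbabilityMeasure ((volume : Measure ℝ).restrict (Icc 0 1)) := ⟨by simp⟩
  exact Measure.isProbabilityMeasure_map (continuous_lineMap_param a b).aemeasurable

instance isFiniteMeasure_edgeMeasure (A : Matrix (Source lam) (Sink lam) ℝ) :
    IsFiniteMeasure (edgeMeasure x lam A) := by
  have (i : Source lam) (j : Sink lam) :
      IsFiniteMeasure (edgeMass x lam A i j • uniformOnSegment (x i) (x j)) :=
    Measure.smul_finite _ ENNReal.ofReal_ne_top
  rw [edgeMeasure]
  infer_instance

lemma edgeMeasure_apply (A : Matrix (Source lam) (Sink lam) ℝ) (s : Set (Eu k)) :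
    edgeMeasure x lam A s = ∑ i, ∑ j, edgeMass x lam A i j * uniformOnSegment (x i) (x j) s := by
  simp [edgeMeasure]

lemma isProbabilityMeasure_edgeMeasure (hlam : ∑ i, lam i = 0) (hW : 0 < wasserstein x lam)
    {A : Matrix (Source lam) (Sink lam) ℝ} (hA : IsOptimalPlan x lam A) :
    IsProbabilityMeasure (edgeMeasure x lam A) := by
  constructor
  have hnn (i : Source lam) (j : Sink lam) : 0 ≤ A i j * dist (x i) (x j) / wasserstein x lam :=
    div_nonneg (mul_nonneg (hA.1.1 i j) dist_nonneg) hW.le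
  simp only [edgeMeasure_apply, measure_univ, mul_one, edgeMass]
  simp_rw [← ENNReal.ofReal_sum_of_nonneg fun j _ => hnn _ j]
  rw [← ENNReal.ofReal_sum_of_nonneg fun i _ => Finset.sum_nonneg fun j _ => hnn i j]
  simp_rw [← Finset.sum_div]
  rw [show ∑ i, ∑ j, A i j * dist (x i) (x j) = wasserstein x lam from hA.cost_eq hlam,
    div_self hW.ne', ENNReal.ofReal_one]

lemma integral_uniformOnSegment {F : Type*} [NormedAddCommGroup F] [NormedSpace ℝ F]
    {g : Eu k → F} (hg : Continuous g) (a b : Eu k) :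
    ∫ y, g y ∂uniformOnSegment a b = ∫ s in (0 : ℝ)..1, g (AffineMap.lineMap a b s) := by
  rw [uniformOnSegment, integral_map (continuous_lineMap_param a b).aemeasurable
    hg.aestronglyMeasurable, integral_Icc_eq_integral_Ioc,
    intervalIntegral.integral_of_le zero_le_one]

/-- The right-hand cost is minus the `t`-derivative of the perturbed cost of `A`, which links the
perturbation to edge measures. -/
lemma integral_edgeMeasure (hW : 0 < wasserstein x lam) {A : Matrix (Source lam) (Sink lam) ℝ}
    (hA : A ∈ plans lam) {ψ : Eu k → ℝ} (hψ : Continuous ψ) (hc : HasCompactSupport ψ) :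
    wasserstein x lam * ∫ y, ψ y ∂edgeMeasure x lam A
      = planCost (fun i j => dist (x i) (x j) * segAvg ψ (x i) (x j)) A := by
  have hi (i : Source lam) (j : Sink lam) :
      Integrable ψ (edgeMass x lam A i j • uniformOnSegment (x i) (x j)) :=
    (hψ.integrable_of_hasCompactSupport hc).smul_measure ENNReal.ofReal_ne_top
  rw [edgeMeasure, integral_finsetSum_measure fun i _ =>
    integrable_finsetSum_measure.2 fun j _ => hi i j, Finset.mul_sum, planCost]
  refine Finset.sum_congr rfl fun i _ => ?_
  rw [integral_finsetSum_measure fun j _ => hi i j, Finset.mul_sum]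
  refine Finset.sum_congr rfl fun j _ => ?_
  rw [integral_smul_measure, integral_uniformOnSegment hψ, edgeMass, ENNReal.toReal_ofReal
    (div_nonneg (mul_nonneg (hA.1 i j) dist_nonneg) hW.le), segAvg, smul_eq_mul]
  field_simp

/-- Finite measures are determined by the integrals of smooth compactly supported functions. -/
lemma measure_eq_of_integral_contDiff_eq {F : Type*} [NormedAddCommGroup F] [NormedSpace ℝ F]
    [FiniteDimensional ℝ F] [MeasurableSpace F] [BorelSpace F] {μ ν : Measure F}
    [IsFiniteMeasure μ] [IsFiniteMeasure ν] (h : ∀ ψ : F → ℝ, ContDiff ℝ ∞ ψ → HasCompactSupport ψ →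
      ∫ y, ψ y ∂μ = ∫ y, ψ y ∂ν) : μ = ν := by
  -- Both measures have densities with respect to `μ + ν`, and test functions determine locally
  -- integrable densities.
  have hμ : μ ≪ μ + ν := Measure.AbsolutelyContinuous.rfl.add_right ν
  have hν : ν ≪ μ + ν := by
    rw [add_comm]; exact Measure.AbsolutelyContinuous.rfl.add_right μ
  have hμi : Integrable (fun y => (μ.rnDeriv (μ + ν) y).toReal) (μ + ν) :=
    Measure.integrable_toReal_rnDeriv
  have hνi : Integrable (fun y => (ν.rnDeriv (μ + ν) y).toReal) (μ + ν) :=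
    Measure.integrable_toReal_rnDeriv
  have hae : ∀ᵐ y ∂(μ + ν), (μ.rnDeriv (μ + ν) y).toReal = (ν.rnDeriv (μ + ν) y).toReal := by
    refine ae_eq_of_integral_contDiff_smul_eq hμi.locallyIntegrable hνi.locallyIntegrable
      fun ψ hψ hc => ?_
    have h1 := integral_rnDeriv_smul (f := ψ) hμ
    have h2 := integral_rnDeriv_smul (f := ψ) hν
    simp_rw [smul_eq_mul, mul_comm (ψ _)]
    simp only [smul_eq_mul] at h1 h2
    rw [h1, h2, h ψ hψ hc]
  rw [← Measure.withDensity_rnDeriv_eq μ (μ + ν) hμ]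
  refine Eq.trans (withDensity_congr_ae ?_) (Measure.withDensity_rnDeriv_eq ν (μ + ν) hν)
  filter_upwards [hae, Measure.rnDeriv_lt_top μ (μ + ν), Measure.rnDeriv_lt_top ν (μ + ν)]
    with y hy h1 h2
  exact (ENNReal.toReal_eq_toReal_iff' h1.ne h2.ne).1 hy

end Edge

/-! ### The lower bound for the action -/

section Action

variable {k n : ℕ} {x : Fin n → Eu k} {lam : Fin n → ℝ} {μ : Measure (Eu k)}
  {E : VectorMeasure (Eu k) (Eu k)}

lemma action_zero (μ : Measure (Eu k)) (E : VectorMeasure (Eu k) (Eu k)) :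
    action (fun _ => 0) μ E = 1 / 2 * ∫ y, ‖fluxDensity μ E y‖ ^ 2 ∂μ := by
  simp [action]

/-- The unperturbed case `ψ = 0`, `t = 0` of the duality bound. -/
lemma IsAdmissible.wasserstein_le_integral (hE : IsAdmissible x lam μ E) (hlam : ∑ i, lam i = 0)
    (h0 : lam ≠ 0) : wasserstein x lam ≤ ∫ y, ‖fluxDensity μ E y‖ ∂μ := by
  have := nonempty_source hlam h0
  obtain ⟨C, δ, hδ, h⟩ := hE.exists_planCost_le hlam (ψ := fun _ => 0) contDiff_const
    HasCompactSupport.zero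
  obtain ⟨A, hA, hle⟩ := h 0 le_rfl hδ.le
  simp only [perturbedDist, zero_mul, sub_zero, mul_one, ne_eq, OfNat.ofNat_ne_zero,
    not_false_eq_true, zero_pow, add_zero, one_mul] at hle
  refine (wasserstein_le hlam hA).trans (le_of_eq_of_le ?_ hle)
  rw [cost_eq_planCost]
  simp only [dist_eq_norm, norm_sub_rev]

/-- With `c = W` this replaces Cauchy–Schwarz: nonnegativity gives the lower bound for the action,
vanishing gives the equality case. -/
lemma IsAdmissible.integral_sq_sub (hE : IsAdmissible x lam μ E) (c : ℝ) :
    Integrable (fun y => (‖fluxDensity μ E y‖ - c) ^ 2) μ ∧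
    ∫ y, (‖fluxDensity μ E y‖ - c) ^ 2 ∂μ
      = ∫ y, ‖fluxDensity μ E y‖ ^ 2 ∂μ - 2 * c * ∫ y, ‖fluxDensity μ E y‖ ∂μ + c ^ 2 := by
  have := hE.isProbabilityMeasure
  have h1 : Integrable (fun y => ‖fluxDensity μ E y‖ ^ 2) μ := hE.memLp.integrable_norm_pow two_ne_zero
  have h2 := (integrable_fluxDensity μ E).norm.const_mul (2 * c)
  have h3 : (fun y => (‖fluxDensity μ E y‖ - c) ^ 2) = fun y =>
      ‖fluxDensity μ E y‖ ^ 2 - 2 * c * ‖fluxDensity μ E y‖ + c ^ 2 := by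
    ext y; ring
  rw [h3]
  refine ⟨(h1.sub h2).add (integrable_const _), ?_⟩
  rw [integral_add (f := fun y => _ - _) (h1.sub h2) (integrable_const _), integral_sub h1 h2, integral_const_mul]
  simp

lemma IsAdmissible.sq_wasserstein_le (hE : IsAdmissible x lam μ E) (hlam : ∑ i, lam i = 0) :
    wasserstein x lam ^ 2 ≤ ∫ y, ‖fluxDensity μ E y‖ ^ 2 ∂μ := by
  by_cases h0 : lam = 0
  · subst h0
    rw [wasserstein_eq_zero, zero_pow two_ne_zero]
    exact integral_nonneg fun y => sq_nonneg _
  have h1 := hE.wasserstein_le_integral hlam h0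
  have h2 := (hE.integral_sq_sub (wasserstein x lam)).2
  have h3 : 0 ≤ ∫ y, (‖fluxDensity μ E y‖ - wasserstein x lam) ^ 2 ∂μ :=
    integral_nonneg fun y => sq_nonneg _
  have h4 : 0 ≤ wasserstein x lam := by
    obtain ⟨B, hB, hBW⟩ := (isLeast_wasserstein x hlam).1
    rw [← hBW]
    exact Finset.sum_nonneg fun i _ => Finset.sum_nonneg fun j _ =>
      mul_nonneg (hB.1 i j) dist_nonneg
  nlinarith

lemma IsAdmissible.norm_fluxDensity_ae_eq (hE : IsAdmissible x lam μ E) (hlam : ∑ i, lam i = 0)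
    (h0 : lam ≠ 0) (hW : 0 < wasserstein x lam)
    (hmin : ∫ y, ‖fluxDensity μ E y‖ ^ 2 ∂μ ≤ wasserstein x lam ^ 2) :
    ∀ᵐ y ∂μ, ‖fluxDensity μ E y‖ = wasserstein x lam := by
  have h1 := hE.wasserstein_le_integral hlam h0
  obtain ⟨hi, h2⟩ := hE.integral_sq_sub (wasserstein x lam)
  have h3 : ∫ y, (‖fluxDensity μ E y‖ - wasserstein x lam) ^ 2 ∂μ = 0 :=
    le_antisymm (by nlinarith) (integral_nonneg fun y => sq_nonneg _)
  rw [integral_eq_zero_iff_of_nonneg (fun y => sq_nonneg _) hi] at h3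
  filter_upwards [h3] with y hy
  have := pow_eq_zero_iff two_ne_zero |>.1 hy
  linarith

end Action

/-! ### Structure of the minimizers -/

section Structure

open Filter Topology

variable {k n : ℕ} {x : Fin n → Eu k} {lam : Fin n → ℝ} {μ : Measure (Eu k)}
  {E : VectorMeasure (Eu k) (Eu k)}

/-- For every test function, the integral against a minimizer is at most the integral against the
edge measure of some optimal plan. -/
lemma IsAdmissible.exists_isOptimalPlan_le (hE : IsAdmissible x lam μ E) (hlam : ∑ i, lam i = 0)
    [Nonempty (Source lam)]
    (hf : ∀ᵐ y ∂μ, ‖fluxDensity μ E y‖ = wasserstein x lam)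
    {ψ : Eu k → ℝ} (hψ : ContDiff ℝ ∞ ψ) (hc : HasCompactSupport ψ) :
    ∃ A, IsOptimalPlan x lam A ∧ wasserstein x lam * ∫ y, ψ y ∂μ
      ≤ planCost (fun i j => dist (x i) (x j) * segAvg ψ (x i) (x j)) A := by
  have := hE.isProbabilityMeasure
  set W := wasserstein x lam
  set I := ∫ y, ψ y ∂μ
  let c : Source lam → Sink lam → ℝ := fun i j => dist (x i) (x j) * segAvg ψ (x i) (x j)
  have hψi : Integrable ψ μ := hψ.continuous.integrable_of_hasCompactSupport hc
  obtain ⟨C, δ, hδ, h⟩ := hE.exists_planCost_le hlam hψ hc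
  have hint (t : ℝ) : ∫ y, (1 - t * ψ y + t ^ 2 * C ^ 2) * ‖fluxDensity μ E y‖ ∂μ
      = W * (1 - t * I + t ^ 2 * C ^ 2) := by
    have h1 : ∫ y, (1 - t * ψ y + t ^ 2 * C ^ 2) * ‖fluxDensity μ E y‖ ∂μ
        = ∫ y, (W * (1 + t ^ 2 * C ^ 2) - W * t * ψ y) ∂μ := by
      refine integral_congr_ae ?_
      filter_upwards [hf] with y hy
      rw [hy]
      ring
    rw [h1, integral_sub (integrable_const _) (hψi.const_mul _), integral_const_mul (W * t)]
    simp only [integral_const, probReal_univ, one_smul]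
    ring
  have hcost (t : ℝ) (A : Matrix (Source lam) (Sink lam) ℝ) :
      planCost (fun i j => perturbedDist ψ t (x i) (x j)) A = cost x lam A - t * planCost c A := by
    simp only [planCost, cost, Finset.mul_sum, ← Finset.sum_sub_distrib]
    refine Finset.sum_congr rfl fun i _ => Finset.sum_congr rfl fun j _ => ?_
    rw [perturbedDist, dist_comm, dist_eq_norm]
    simp only [c]
    rw [dist_comm, dist_eq_norm]
    ring
  let t : ℕ → ℝ := fun m => δ * (1 / ((m : ℝ) + 1))
  have ht0 (m : ℕ) : 0 < t m := by positivity
  have htδ (m : ℕ) : t m ≤ δ := by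
    refine mul_le_of_le_one_right hδ.le ?_
    rw [div_le_one (by positivity)]
    linarith [(Nat.cast_nonneg m : (0 : ℝ) ≤ m)]
  have ht : Tendsto t atTop (𝓝 0) := by
    rw [← mul_zero δ]
    exact (tendsto_one_div_add_atTop_nhds_zero_nat (𝕜 := ℝ)).const_mul δ
  choose A hA hAle using fun m => h (t m) (ht0 m).le (htδ m)
  simp only [hint, hcost] at hAle
  have : FirstCountableTopology (Matrix (Source lam) (Sink lam) ℝ) :=
    inferInstanceAs (FirstCountableTopology (Source lam → Sink lam → ℝ))
  obtain ⟨A₀, hA₀, σ, hσ, hlim⟩ := (isCompact_plans lam).tendsto_subseq hA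
  have htσ : Tendsto (fun m => t (σ m)) atTop (𝓝 0) := ht.comp hσ.tendsto_atTop
  have hcl : Tendsto (fun m => planCost c (A (σ m))) atTop (𝓝 (planCost c A₀)) :=
    ((continuous_planCost c).tendsto A₀).comp hlim
  have hdl : Tendsto (fun m => cost x lam (A (σ m))) atTop (𝓝 (cost x lam A₀)) :=
    (continuous_cost.tendsto A₀).comp hlim
  refine ⟨A₀, (isOptimalPlan_iff hlam).2 ⟨hA₀, ?_⟩, ?_⟩
  · have h1 : Tendsto (fun m => W * (1 - t (σ m) * I + t (σ m) ^ 2 * C ^ 2)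
        + t (σ m) * planCost c (A (σ m))) atTop
        (𝓝 (W * (1 - 0 * I + 0 ^ 2 * C ^ 2) + 0 * planCost c A₀)) :=
      (((tendsto_const_nhds.sub (htσ.mul_const I)).add ((htσ.pow 2).mul_const _)).const_mul W).add
        (htσ.mul hcl)
    have h2 := le_of_tendsto_of_tendsto' hdl h1 fun m => by linarith [hAle (σ m)]
    simpa using h2
  · have h1 : Tendsto (fun m => planCost c (A (σ m)) + W * (t (σ m) * C ^ 2)) atTop
        (𝓝 (planCost c A₀ + W * (0 * C ^ 2))) :=
      hcl.add ((htσ.mul_const _).const_mul W)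
    -- Each `A (σ m)` costs at least `W`, which cancels the zeroth-order terms; the rest is divided
    -- by `t`.
    have h2 : W * I ≤ planCost c A₀ + W * (0 * C ^ 2) := ge_of_tendsto' h1 fun m => by
      have h3 := hAle (σ m)
      have h4 : W ≤ cost x lam (A (σ m)) := wasserstein_le hlam (hA (σ m))
      have h5 := ht0 (σ m)
      refine le_of_mul_le_mul_left ?_ h5
      nlinarith
    simpa using h2

lemma segAvg_sum {ι : Type*} (s : Finset ι) (r : ι → ℝ) (ψ : ι → Eu k → ℝ)
    (hψ : ∀ l ∈ s, Continuous (ψ l)) (a b : Eu k) :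
    segAvg (fun y => ∑ l ∈ s, r l * ψ l y) a b = ∑ l ∈ s, r l * segAvg (ψ l) a b := by
  rw [segAvg, intervalIntegral.integral_finsetSum
    (f := fun l s => r l * ψ l (AffineMap.lineMap a b s)) fun l hl => ((hψ l hl).comp (continuous_lineMap_param a b)).const_mul _ |>.intervalIntegrable _ _]
  simp only [intervalIntegral.integral_const_mul, segAvg]

/-- The minimizers are edge measures of optimal plans. -/
lemma IsAdmissible.exists_eq_edgeMeasure (hE : IsAdmissible x lam μ E) (hlam : ∑ i, lam i = 0)
    (h0 : lam ≠ 0) (hW : 0 < wasserstein x lam)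
    (hmin : ∫ y, ‖fluxDensity μ E y‖ ^ 2 ∂μ ≤ wasserstein x lam ^ 2) :
    ∃ A, IsOptimalPlan x lam A ∧ μ = edgeMeasure x lam A := by
  have := hE.isProbabilityMeasure
  have := nonempty_source hlam h0
  have hf := hE.norm_fluxDensity_ae_eq hlam h0 hW hmin
  set W := wasserstein x lam
  let ι := {ψ : Eu k → ℝ // ContDiff ℝ ∞ ψ ∧ HasCompactSupport ψ}
  let c (ψ : Eu k → ℝ) : Source lam → Sink lam → ℝ :=
    fun i j => dist (x i) (x j) * segAvg ψ (x i) (x j)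
  let O : Set (Matrix (Source lam) (Sink lam) ℝ) := plans lam ∩ {A | cost x lam A ≤ W}
  have hOmem (A : Matrix (Source lam) (Sink lam) ℝ) : A ∈ O ↔ IsOptimalPlan x lam A :=
    (isOptimalPlan_iff hlam).symm
  have hOc : IsCompact O :=
    (isCompact_plans lam).inter_right (isClosed_le continuous_cost continuous_const)
  have hOconv : Convex ℝ O := by
    refine (convex_plans lam).inter fun A hA B hB s t hs ht hst => ?_
    simp only [mem_ofPred_eq, cost_eq_planCost] at hA hB ⊢
    rw [planCost_add_smul]
    calc _ ≤ s * W + t * W := by gcongr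
      _ = W := by rw [← add_mul, hst, one_mul]
  -- Each test function imposes a closed condition on the compact set of optimal plans, so finitely
  -- many conditions at a time suffice.
  have hfip := hOc.inter_iInter_nonempty
    (fun ψ : ι => {A | planCost (c ψ.1) A = W * ∫ y, ψ.1 y ∂μ})
    (fun ψ => isClosed_eq (continuous_planCost _) continuous_const) fun s => by
      let T : Matrix (Source lam) (Sink lam) ℝ → s → ℝ := fun A ψ => planCost (c ψ.1.1) A
      have hT : IsLinearMap ℝ T := by
        constructor
        · intro A B
          ext ψ
          simpa using planCost_add_smul (c ψ.1.1) 1 1 A B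
        · intro r A
          ext ψ
          simpa using planCost_add_smul (c ψ.1.1) r 0 A 0
      have hTc : Continuous T := continuous_pi fun ψ => continuous_planCost _
      by_cases hmem : (fun ψ : s => W * ∫ y, ψ.1.1 y ∂μ) ∈ T '' O
      · obtain ⟨A, hA, hAT⟩ := hmem
        exact ⟨A, hA, mem_iInter₂.2 fun ψ hψ => congrFun hAT ⟨ψ, hψ⟩⟩
      exfalso
      -- A separating functional is a linear combination of the chosen test functions. That
      -- combination is itself a test function whose integral against `μ` would beat every optimal
      -- plan, contradicting `IsAdmissible.exists_isOptimalPlan_le`.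
      obtain ⟨f, u, hfu, huf⟩ := geometric_hahn_banach_closed_point
        (hOconv.is_linear_image hT) (hOc.image hTc).isClosed hmem
      classical
      let r : s → ℝ := fun ψ => f (Pi.single ψ 1)
      have hfr (z : s → ℝ) : f z = ∑ ψ, r ψ * z ψ := by
        conv_lhs => rw [← Finset.univ_sum_single z]
        rw [map_sum]
        refine Finset.sum_congr rfl fun ψ _ => ?_
        rw [← mul_one (z ψ), ← smul_eq_mul (z ψ) 1, Pi.single_smul, map_smul, smul_eq_mul,
          smul_eq_mul, mul_one, mul_comm]
      obtain ⟨A, hA, hle⟩ := hE.exists_isOptimalPlan_le hlam hf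
        (ψ := fun y => ∑ ψ : s, r ψ * ψ.1.1 y)
        (ContDiff.sum fun ψ _ => contDiff_const.mul ψ.1.2.1)
        (by
          refine HasCompactSupport.intro (s.isCompact_biUnion fun ψ _ => ψ.2.2.isCompact)
            fun y hy => Finset.sum_eq_zero fun ψ _ => ?_
          rw [image_eq_zero_of_notMem_tsupport fun h =>
            hy (mem_iUnion₂.2 ⟨ψ.1, ψ.2, h⟩), mul_zero])
      have h1 := hfu _ ⟨A, (hOmem A).2 hA, rfl⟩
      have h2 : planCost (fun i j => dist (x i) (x j) *
          segAvg (fun y => ∑ ψ : s, r ψ * ψ.1.1 y) (x i) (x j)) A = f (T A) := by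
        simp only [segAvg_sum _ r (fun ψ : s => ψ.1.1) fun ψ _ => ψ.1.2.1.continuous]
        rw [hfr]
        simp only [planCost, Finset.mul_sum, T, c]
        conv_rhs => rw [Finset.sum_comm]
        refine Finset.sum_congr rfl fun i _ => ?_
        conv_rhs => rw [Finset.sum_comm]
        exact Finset.sum_congr rfl fun j _ => Finset.sum_congr rfl fun ψ _ => by ring
      have h3 : W * ∫ y, ∑ ψ : s, r ψ * ψ.1.1 y ∂μ = f fun ψ : s => W * ∫ y, ψ.1.1 y ∂μ := by
        rw [hfr, integral_finsetSum _ fun ψ _ =>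
          (ψ.1.2.1.continuous.integrable_of_hasCompactSupport ψ.1.2.2).const_mul _, Finset.mul_sum]
        refine Finset.sum_congr rfl fun ψ _ => ?_
        rw [integral_const_mul]
        ring
      rw [h2, h3] at hle
      linarith
  obtain ⟨A, hA, hAψ⟩ := hfip
  have hopt := (hOmem A).1 hA
  refine ⟨A, hopt, measure_eq_of_integral_contDiff_eq fun ψ hψ hc => ?_⟩
  have h1 : planCost (c ψ) A = W * ∫ y, ψ y ∂μ := mem_iInter.1 hAψ ⟨ψ, hψ, hc⟩
  exact mul_left_cancel₀ hW.ne' (h1.symm.trans (integral_edgeMeasure hW hopt.1 hψ.continuous hc).symm)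

end Structure

/-! ### The flux carried by the edges -/

section Construction

variable {k n : ℕ} {x : Fin n → Eu k} {lam : Fin n → ℝ}
  {A : Matrix (Source lam) (Sink lam) ℝ}

lemma integral_fderiv_uniformOnSegment {φ : Eu k → ℝ} (hφ : ContDiff ℝ ∞ φ) (a b : Eu k) :
    ∫ y, fderiv ℝ φ y (b - a) ∂uniformOnSegment a b = φ b - φ a := by
  have hd : Continuous (fderiv ℝ φ) := hφ.continuous_fderiv (by simp)
  rw [integral_uniformOnSegment (hd.clm_apply continuous_const)]
  have hder (s : ℝ) : HasDerivAt (fun s : ℝ => φ (AffineMap.lineMap a b s))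
      (fderiv ℝ φ (AffineMap.lineMap a b s) (b - a)) s := by
    have h2 : HasDerivAt (fun s : ℝ => AffineMap.lineMap a b s) (b - a) s := by
      simpa using (AffineMap.hasDerivAt_lineMap (a := a) (b := b) (x := s))
    exact (hφ.differentiable (by simp) (AffineMap.lineMap a b s)).hasFDerivAt.comp_hasDerivAt s h2
  rw [intervalIntegral.integral_eq_sub_of_hasDerivAt (fun s _ => hder s)
    (((hd.comp (continuous_lineMap_param a b)).clm_apply continuous_const).intervalIntegrable _ _)]
  simp

/-- The share of the edge `L(i,j)` in the edge measure. -/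
noncomputable def edgeShare (x : Fin n → Eu k) (lam : Fin n → ℝ)
    (A : Matrix (Source lam) (Sink lam) ℝ) (i : Source lam) (j : Sink lam) (y : Eu k) : ℝ :=
  ((edgeMass x lam A i j • uniformOnSegment (x i) (x j)).rnDeriv (edgeMeasure x lam A) y).toReal

/-- The flux density on the edges: a vector of length `W` in the direction of the edges. -/
noncomputable def edgeFlux (x : Fin n → Eu k) (lam : Fin n → ℝ)
    (A : Matrix (Source lam) (Sink lam) ℝ) (y : Eu k) : Eu k :=
  ∑ i, ∑ j, edgeShare x lam A i j y •
    ((wasserstein x lam / dist (x i) (x j)) • (x j - x i))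

instance isFiniteMeasure_edge (i : Source lam) (j : Sink lam) :
    IsFiniteMeasure (edgeMass x lam A i j • uniformOnSegment (x i) (x j)) :=
  Measure.smul_finite _ ENNReal.ofReal_ne_top

instance haveLebesgueDecomposition_edge (i : Source lam) (j : Sink lam) :
    (edgeMass x lam A i j • uniformOnSegment (x i) (x j)).HaveLebesgueDecomposition
      (edgeMeasure x lam A) :=
  Measure.haveLebesgueDecomposition_of_sigmaFinite _ _

lemma edge_absolutelyContinuous (i : Source lam) (j : Sink lam) :
    edgeMass x lam A i j • uniformOnSegment (x i) (x j) ≪ edgeMeasure x lam A := by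
  refine Measure.AbsolutelyContinuous.mk fun s _ hs => ?_
  rw [edgeMeasure_apply, Finset.sum_eq_zero_iff] at hs
  exact Finset.sum_eq_zero_iff.1 (hs i (Finset.mem_univ i)) j (Finset.mem_univ j)

/-- The edge pieces add up to the edge measure, so their densities add up to one. -/
lemma sum_edgeShare_ae_eq (x : Fin n → Eu k) (lam : Fin n → ℝ)
    (A : Matrix (Source lam) (Sink lam) ℝ) :
    ∀ᵐ y ∂edgeMeasure x lam A, ∑ i, ∑ j, edgeShare x lam A i j y = 1 := by
  set μ := edgeMeasure x lam A with hμ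
  let ν (i : Source lam) (j : Sink lam) := edgeMass x lam A i j • uniformOnSegment (x i) (x j)
  have hm (i : Source lam) (j : Sink lam) : Measurable ((ν i j).rnDeriv μ) :=
    Measure.measurable_rnDeriv _ _
  have h1 : (fun y => ∑ i, ∑ j, (ν i j).rnDeriv μ y) =ᵐ[μ] fun _ => 1 := by
    refine ae_eq_of_forall_setLIntegral_eq_of_sigmaFinite (by fun_prop) measurable_const
      fun s hs _ => ?_
    rw [lintegral_finsetSum _ fun i _ => by fun_prop]
    simp_rw [lintegral_finsetSum _ fun j _ => hm _ j]
    simp only [lintegral_one, Measure.restrict_apply_univ]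
    rw [hμ, edgeMeasure_apply]
    refine Finset.sum_congr rfl fun i _ => Finset.sum_congr rfl fun j _ => ?_
    exact Measure.setLIntegral_rnDeriv (edge_absolutelyContinuous i j) s
  have h2 (i : Source lam) (j : Sink lam) : ∀ᵐ y ∂μ, (ν i j).rnDeriv μ y < ⊤ :=
    Measure.rnDeriv_lt_top _ _
  filter_upwards [h1, ae_all_iff.2 fun i => ae_all_iff.2 (h2 i)] with y hy hfin
  have h3 := congrArg ENNReal.toReal hy
  rw [ENNReal.toReal_sum fun i _ => (ENNReal.sum_lt_top.2 fun j _ => hfin i j).ne] at h3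
  simp_rw [ENNReal.toReal_sum fun j _ => (hfin _ j).ne] at h3
  exact h3.trans ENNReal.toReal_one

/-- The flux is almost everywhere a convex combination of vectors of length `W`. An inequality
suffices, because `IsAdmissible.sq_wasserstein_le` supplies the reverse bound. -/
lemma norm_edgeFlux_ae_le (hx : Function.Injective x) (hW : 0 < wasserstein x lam)
    (A : Matrix (Source lam) (Sink lam) ℝ) :
    ∀ᵐ y ∂edgeMeasure x lam A, ‖edgeFlux x lam A y‖ ≤ wasserstein x lam := by
  filter_upwards [sum_edgeShare_ae_eq x lam A] with y hy
  have h1 (i : Source lam) (j : Sink lam) : ‖edgeShare x lam A i j y •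
      ((wasserstein x lam / dist (x i) (x j)) • (x j - x i))‖
      ≤ edgeShare x lam A i j y * wasserstein x lam := by
    have hd : 0 < dist (x i) (x j) := dist_pos.2 (hx.ne (source_ne_sink i j))
    rw [norm_smul, norm_smul,
      Real.norm_of_nonneg (show 0 ≤ edgeShare x lam A i j y from ENNReal.toReal_nonneg),
      Real.norm_of_nonneg (by positivity), ← dist_eq_norm, dist_comm (x j),
      div_mul_cancel₀ _ hd.ne']
  calc ‖edgeFlux x lam A y‖ ≤ ∑ i, ∑ j, edgeShare x lam A i j y * wasserstein x lam :=
        (norm_sum_le _ _).trans (Finset.sum_le_sum fun i _ =>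
          (norm_sum_le _ _).trans (Finset.sum_le_sum fun j _ => h1 i j))
    _ = wasserstein x lam := by simp_rw [← Finset.sum_mul]; rw [hy, one_mul]

lemma integrable_edgeShare (A : Matrix (Source lam) (Sink lam) ℝ) (i : Source lam)
    (j : Sink lam) : Integrable (edgeShare x lam A i j) (edgeMeasure x lam A) :=
  Measure.integrable_toReal_rnDeriv

lemma integrable_edgeFlux (A : Matrix (Source lam) (Sink lam) ℝ) :
    Integrable (edgeFlux x lam A) (edgeMeasure x lam A) :=
  integrable_finsetSum _ fun i _ => integrable_finsetSum _ fun j _ =>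
    (integrable_edgeShare A i j).smul_const _

/-- Along an edge, mass times speed leaves `A i j` times the increment of `φ`; the marginal
conditions collect these increments into the sources and sinks. -/
lemma integral_fderiv_edgeFlux (hx : Function.Injective x)
    (hW : 0 < wasserstein x lam) (hA : A ∈ plans lam) {φ : Eu k → ℝ} (hφ : ContDiff ℝ ∞ φ)
    (hc : HasCompactSupport φ) :
    - ∫ y, fderiv ℝ φ y (edgeFlux x lam A y) ∂edgeMeasure x lam A = ∑ i, lam i * φ (x i) := by
  have hd : Continuous (fderiv ℝ φ) := hφ.continuous_fderiv (by simp)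
  obtain ⟨C, hC⟩ := (hc.fderiv (𝕜 := ℝ)).exists_bound_of_continuous hd
  let v (i : Source lam) (j : Sink lam) : Eu k :=
    (wasserstein x lam / dist (x i) (x j)) • (x j - x i)
  have hint (i : Source lam) (j : Sink lam) :
      Integrable (fun y => edgeShare x lam A i j y * fderiv ℝ φ y (v i j))
        (edgeMeasure x lam A) := by
    refine (integrable_edgeShare A i j).mul_bdd (c := C * ‖v i j‖)
      (hd.clm_apply continuous_const).aestronglyMeasurable (.of_forall fun y => ?_)
    exact ((fderiv ℝ φ y).le_opNorm _).trans (by gcongr; exact hC y)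
  have hval (i : Source lam) (j : Sink lam) :
      ∫ y, edgeShare x lam A i j y * fderiv ℝ φ y (v i j) ∂edgeMeasure x lam A
        = A i j * (φ (x j) - φ (x i)) := by
    have hdist : 0 < dist (x i) (x j) := dist_pos.2 (hx.ne (source_ne_sink i j))
    have h1 := integral_rnDeriv_smul (f := fun y => fderiv ℝ φ y (v i j))
      (edge_absolutelyContinuous (x := x) (A := A) i j)
    simp only [smul_eq_mul] at h1
    refine h1.trans ?_
    rw [integral_smul_measure]
    simp only [v, map_smul, smul_eq_mul]
    rw [integral_const_mul, integral_fderiv_uniformOnSegment hφ, edgeMass, ENNReal.toReal_ofReal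
      (div_nonneg (mul_nonneg (hA.1 i j) dist_nonneg) hW.le)]
    field_simp
  have hsum : ∫ y, fderiv ℝ φ y (edgeFlux x lam A y) ∂edgeMeasure x lam A
      = ∑ i, ∑ j, A i j * (φ (x j) - φ (x i)) := by
    have hexp (y : Eu k) : fderiv ℝ φ y (edgeFlux x lam A y)
        = ∑ i, ∑ j, edgeShare x lam A i j y * fderiv ℝ φ y (v i j) := by
      simp only [edgeFlux, map_sum]
      exact Finset.sum_congr rfl fun i _ => Finset.sum_congr rfl fun j _ => map_smul _ _ _
    simp_rw [hexp]
    rw [integral_finsetSum _ fun i _ => integrable_finsetSum _ fun j _ => hint i j]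
    refine Finset.sum_congr rfl fun i _ => ?_
    rw [integral_finsetSum _ fun j _ => hint i j]
    exact Finset.sum_congr rfl fun j _ => hval i j
  rw [hsum, ← sum_source_add_sum_sink lam fun i => φ (x i)]
  simp only [mul_sub, Finset.sum_sub_distrib]
  rw [Finset.sum_comm]
  simp only [← Finset.sum_mul, hA.2.1, hA.2.2, neg_mul, Finset.sum_neg_distrib]
  ring

/-- The edge measure of an optimal plan carries an admissible flux of speed at most `W`. -/
lemma exists_isAdmissible_edgeMeasure (hx : Function.Injective x) (hlam : ∑ i, lam i = 0)
    (hW : 0 < wasserstein x lam) (hA : IsOptimalPlan x lam A) :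
    ∃ E, IsAdmissible x lam (edgeMeasure x lam A) E ∧
      ∫ y, ‖fluxDensity (edgeMeasure x lam A) E y‖ ^ 2 ∂edgeMeasure x lam A
        ≤ wasserstein x lam ^ 2 := by
  have := isProbabilityMeasure_edgeMeasure hlam hW hA
  have hF := integrable_edgeFlux (x := x) A
  have hle : ∀ᵐ y ∂edgeMeasure x lam A,
      ‖fluxDensity (edgeMeasure x lam A) ((edgeMeasure x lam A).withDensityᵥ (edgeFlux x lam A)) y‖
        ≤ wasserstein x lam := by
    filter_upwards [fluxDensity_withDensityᵥ hF, norm_edgeFlux_ae_le hx hW A] with y h1 h2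
    rwa [h1]
  refine ⟨(edgeMeasure x lam A).withDensityᵥ (edgeFlux x lam A),
    ⟨this, withDensityᵥ_absolutelyContinuous hF,
      MemLp.of_bound (integrable_fluxDensity _ _).1 _ hle, fun φ hφ hc => ?_⟩, ?_⟩
  · rw [integral_gradient_withDensityᵥ hF hφ hc, integral_fderiv_edgeFlux hx hW hA.1 hφ hc]
  · refine (integral_mono_of_nonneg (.of_forall fun y => sq_nonneg _)
      (integrable_const (wasserstein x lam ^ 2)) ?_).trans (by simp)
    filter_upwards [hle] with y hy
    gcongr

end Construction

/-! ### Support of the edge measures and the minimal action -/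

section Final

variable {k n : ℕ} {x : Fin n → Eu k} {lam : Fin n → ℝ}
  {A : Matrix (Source lam) (Sink lam) ℝ}

lemma measurableSet_segment (a b : Eu k) : MeasurableSet (segment ℝ a b) := by
  rw [segment_eq_image_lineMap]
  exact (isCompact_Icc.image (continuous_lineMap_param a b)).measurableSet

lemma uniformOnSegment_compl (a b : Eu k) : uniformOnSegment a b (segment ℝ a b)ᶜ = 0 := by
  rw [uniformOnSegment, Measure.map_apply (continuous_lineMap_param a b).measurable
    (measurableSet_segment a b).compl, Measure.restrict_apply
    ((continuous_lineMap_param a b).measurable (measurableSet_segment a b).compl)]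
  convert measure_empty (μ := (volume : Measure ℝ))
  ext s
  simp only [mem_inter_iff, mem_preimage, mem_compl_iff, mem_empty_iff_false, iff_false, not_and]
  intro h hs
  exact h (segment_eq_image_lineMap ℝ a b ▸ mem_image_of_mem _ hs)

lemma uniformOnSegment_subsingleton {a b : Eu k} (hab : a ≠ b) {s : Set (Eu k)}
    (hs : s.Subsingleton) : uniformOnSegment a b s = 0 := by
  rw [uniformOnSegment, Measure.map_apply (continuous_lineMap_param a b).measurable
    hs.measurableSet]
  exact (hs.preimage (AffineMap.lineMap_injective ℝ hab)).measure_zero _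

lemma edgeMass_eq_zero {i : Source lam} {j : Sink lam} (h : A i j = 0) :
    edgeMass x lam A i j = 0 := by
  simp [edgeMass, h]

lemma edgeMeasure_compl (hA : A ∈ plans lam) :
    edgeMeasure x lam A (⋃ i, ⋃ j, ⋃ (_ : 0 < A i j), edge x lam i j)ᶜ = 0 := by
  rw [edgeMeasure_apply]
  refine Finset.sum_eq_zero fun i _ => Finset.sum_eq_zero fun j _ => ?_
  rcases (hA.1 i j).eq_or_lt with h | h
  · rw [edgeMass_eq_zero h.symm, zero_mul]
  · refine mul_eq_zero_of_right _ (measure_mono_null (compl_subset_compl.2 ?_)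
      (uniformOnSegment_compl (x i) (x j)))
    exact fun y hy => mem_iUnion.2 ⟨i, mem_iUnion.2 ⟨j, mem_iUnion.2 ⟨h, hy⟩⟩⟩

/-- Any other active edge meets `s` in at most one point, which its uniform measure does not charge
since its end points differ. -/
lemma edgeMeasure_apply_of_subset_edge (hx : Function.Injective x) (hA : A ∈ plans lam)
    {i : Source lam} {j : Sink lam}
    (h : ∀ i' j', 0 < A i' j' → (i', j') ≠ (i, j) →
      (edge x lam i j ∩ edge x lam i' j').Subsingleton)
    {s : Set (Eu k)} (hs : s ⊆ edge x lam i j) :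
    edgeMeasure x lam A s = edgeMass x lam A i j * uniformOnSegment (x i) (x j) s := by
  have hother (i' : Source lam) (j' : Sink lam) (hne : (i', j') ≠ (i, j)) :
      edgeMass x lam A i' j' * uniformOnSegment (x i') (x j') s = 0 := by
    rcases (hA.1 i' j').eq_or_lt with h0 | h0
    · rw [edgeMass_eq_zero h0.symm, zero_mul]
    · refine mul_eq_zero_of_right _ (measure_mono_null ?_ (measure_union_null
        (uniformOnSegment_subsingleton (hx.ne (source_ne_sink i' j')) (h i' j' h0 hne))
        (uniformOnSegment_compl (x i') (x j'))))
      intro y hy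
      by_cases hy' : y ∈ edge x lam i' j'
      · exact .inl ⟨hs hy, hy'⟩
      · exact .inr hy'
  rw [edgeMeasure_apply, Finset.sum_eq_single i, Finset.sum_eq_single j]
  · exact fun j' _ hne => hother i j' fun heq => hne (Prod.ext_iff.1 heq).2
  · simp
  · exact fun i' _ hne => Finset.sum_eq_zero fun j' _ =>
      hother i' j' fun heq => hne (Prod.ext_iff.1 heq).1
  · simp

lemma uniformOnSegment_segment (a b : Eu k) : uniformOnSegment a b (segment ℝ a b) = 1 :=
  (prob_compl_eq_zero_iff (measurableSet_segment a b)).1 (uniformOnSegment_compl a b)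

lemma restrict_edgeMeasure (hx : Function.Injective x) (hA : A ∈ plans lam)
    {i : Source lam} {j : Sink lam}
    (h : ∀ i' j', 0 < A i' j' → (i', j') ≠ (i, j) →
      (edge x lam i j ∩ edge x lam i' j').Subsingleton) :
    (edgeMeasure x lam A).restrict (edge x lam i j)
      = edgeMass x lam A i j • uniformOnSegment (x i) (x j) := by
  ext s hs
  rw [Measure.restrict_apply hs, edgeMeasure_apply_of_subset_edge hx hA h inter_subset_right,
    Measure.smul_apply, smul_eq_mul, edge,
    measure_inter_conull (uniformOnSegment_compl (x i) (x j))]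

/-- Without sources and sinks the action vanishes for a vanishing flux. -/
lemma zero_mem_actionValues (x : Fin n → Eu k) :
    (0 : ℝ) ∈ actionValues (fun _ => 0) x (0 : Fin n → ℝ) := by
  have h0 : Integrable (fun _ : Eu k => (0 : Eu k)) (Measure.dirac (0 : Eu k)) :=
    integrable_zero _ _ _
  have hf : fluxDensity (Measure.dirac (0 : Eu k)) ((Measure.dirac (0 : Eu k)).withDensityᵥ
      fun _ => (0 : Eu k)) =ᵐ[Measure.dirac 0] fun _ => 0 := fluxDensity_withDensityᵥ h0
  refine ⟨Measure.dirac 0, (Measure.dirac 0).withDensityᵥ fun _ => 0,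
    ⟨inferInstance, withDensityᵥ_absolutelyContinuous h0, ?_, fun φ hφ hc => ?_⟩, ?_⟩
  · exact (memLp_congr_ae hf).2 MemLp.zero
  · rw [integral_gradient_withDensityᵥ h0 hφ hc]
    simp
  · rw [action_zero, integral_congr_ae (g := fun _ => (0 : ℝ))]
    · simp
    · filter_upwards [hf] with y hy
      simp [hy]

lemma isLeast_actionValues (hx : Function.Injective x) (hlam : ∑ i, lam i = 0) :
    IsLeast (actionValues (fun _ => 0) x lam) (1 / 2 * wasserstein x lam ^ 2) := by
  constructor
  · by_cases h0 : lam = 0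
    · subst h0
      simpa [wasserstein_eq_zero] using zero_mem_actionValues x
    · have hW := wasserstein_pos hx hlam h0
      obtain ⟨A, hA⟩ := exists_isOptimalPlan x hlam
      obtain ⟨E, hE, hle⟩ := exists_isAdmissible_edgeMeasure hx hlam hW hA
      exact ⟨_, E, hE, by rw [action_zero, le_antisymm hle (hE.sq_wasserstein_le hlam)]⟩
  · rintro _ ⟨μ, E, hE, rfl⟩
    rw [action_zero]
    linarith [hE.sq_wasserstein_le hlam]

lemma isActionMinimizer_iff (hx : Function.Injective x) (hlam : ∑ i, lam i = 0) (h0 : lam ≠ 0)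
    (μ : Measure (Eu k)) :
    IsActionMinimizer (fun _ => 0) x lam μ ↔
      ∃ A, IsOptimalPlan x lam A ∧ μ = edgeMeasure x lam A := by
  have hW := wasserstein_pos hx hlam h0
  constructor
  · rintro ⟨E, hE, hmin⟩
    -- Comparison with a pair attaining the known minimum bounds the action of `μ` by `W² / 2`.
    obtain ⟨μ', E', hE', hval⟩ := (isLeast_actionValues hx hlam).1
    have h1 := hmin μ' E' hE'
    rw [← hval, action_zero] at h1
    exact hE.exists_eq_edgeMeasure hlam h0 hW (by linarith)
  · rintro ⟨A, hA, rfl⟩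
    obtain ⟨E, hE, hle⟩ := exists_isAdmissible_edgeMeasure hx hlam hW hA
    refine ⟨E, hE, fun μ' E' hE' => ?_⟩
    rw [action_zero, action_zero]
    linarith [hE'.sq_wasserstein_le hlam]

end Final

end SteadyFlow

theorem mainTheorem2 (k n : ℕ) (x : Fin n → Eu k) (hx : Function.Injective x)
    (lam : Fin n → ℝ) (hlam : ∑ i, lam i = 0) :
    -- an optimal transport plan exists, so that `wasserstein x lam` is the minimal cost
    IsLeast (cost x lam '' plans lam) (wasserstein x lam) ∧
    -- the minimal action
    IsLeast (actionValues (fun _ => 0) x lam) (1 / 2 * wasserstein x lam ^ 2) ∧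
    (lam ≠ 0 →
      0 < wasserstein x lam ∧
      -- the minimizers are exactly the edge measures of the optimal plans
      (∀ μ : Measure (Eu k), IsActionMinimizer (fun _ => 0) x lam μ ↔
        ∃ A, IsOptimalPlan x lam A ∧ μ = edgeMeasure x lam A) ∧
      ∀ A, IsOptimalPlan x lam A →
        -- the support
        edgeMeasure x lam A (⋃ i, ⋃ j, ⋃ (_ : 0 < A i j), edge x lam i j)ᶜ = 0 ∧
        -- an active edge that no other active edge overlaps carries a uniform measure
        ∀ i j, 0 < A i j →
          (∀ i' j', 0 < A i' j' → (i', j') ≠ (i, j) →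
            (edge x lam i j ∩ edge x lam i' j').Subsingleton) →
          edgeMeasure x lam A (edge x lam i j) = edgeMass x lam A i j ∧
          (edgeMeasure x lam A).restrict (edge x lam i j) =
            edgeMass x lam A i j • uniformOnSegment (x i) (x j)) := by
  refine ⟨isLeast_wasserstein x hlam, isLeast_actionValues hx hlam, fun h0 =>
    ⟨wasserstein_pos hx hlam h0, isActionMinimizer_iff hx hlam h0, fun A hA =>
      ⟨edgeMeasure_compl hA.1, fun i j _ h => ⟨?_, restrict_edgeMeasure hx hA.1 h⟩⟩⟩⟩
  rw [edgeMeasure_apply_of_subset_edge hx hA.1 h subset_rfl, edge, uniformOnSegment_segment,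
    mul_one]
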